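/- \textbf{Theorem (Computational Bretagnolle--Huber inequality).} \emph{Functions up to negligible differences.} For $f,g:\mathbb N\to[0,\infty]$ let $d(f,g)=\limsup_{n\to\infty}\delta_n$, where $\delta_n=\exp\big(\tfrac{\log|f(n)-g(n)|}{\log n}\big)$ if $f(n)\ne g(n)$ and $\delta_n=0$ otherwise. A function $h$ is \emph{negligible} if $d(h,0)=0$; write $f\simeq g$ if $d(f,g)=0$, and $f\lesssim g$ if $f\le g+h$ for some negligible $h\ge 0$. Below, a limit of functions of $n$ is a limit for $d$, and a limit inferior of a sequence $(u_k)$ of functions of $n$ is a least upper bound, for the order $\lesssim$, of all $a$ with $a\lesssim u_k$ for all sufficiently large $k$ (both are determined up to $\simeq$). \emph{Complexity-limited tests.} Let $\mathcal H$ be the space of a register of qubits and $G\in\mathbb N$. Let $\mathcal Q(\mathcal H;G)$ be the set of all effects $\Lambda=\langle 0|_{\rm anc}\,U\big[\bigotimes_i A_i\big]U^\dagger\,|0\rangle_{\rm anc}$, where finitely many ancilla qubits in the all-zero state are adjoined, $U$ is realized by a circuit of at most $G$ arbitrary $2$-local unitaries (each acting on at most two arbitrary qubits), and every $A_i\in\{|0\rangle\langle0|,\mathbb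 I\}$, with $A_i=\mathbb I$ for the qubits on which no gate of the circuit acts. For states $\rho,\sigma$ on $\mathcal H$ put $$d_{\rm TV}(\rho,\sigma;G)=\max_{\Lambda\in\mathcal Q(\mathcal H;G)}\operatorname{Tr}[\Lambda(\rho-\sigma)],\qquad D_h^{\epsilon}(\rho\|\sigma;G)=-\log\min_{\Lambda\in\mathcal Q(\mathcal H;G)}\{\operatorname{Tr}[\Lambda\sigma]\,:\,\operatorname{Tr}[\Lambda\rho]\ge1-\epsilon\}.$$ \emph{Computational quantities.} Let $\rho_n,\sigma_n$ $(n\in\mathbb N)$ be states of a register of $N_n$ qubits, for an arbitrary sequence $(N_n)$ of natural numbers. Define, up to $\simeq$, $$\underline d_{\rm TV}(\rho_n,\sigma_n)\simeq\lim_{\ell\to\infty}d_{\rm TV}(\rho_n,\sigma_n;n^\ell),\qquad \underline D(\rho_n\|\sigma_n)\simeq\lim_{\epsilon\to0}\ \lim_{\ell\to\infty}\ \liminf_{k\to\infty}\ \frac1{n^k}D_h^\epsilon\big(\rho_n^{\otimes n^k}\big\|\sigma_n^{\otimes n^k};n^{k\ell}\big),$$ for sequences of states for which these limits exist. \emph{Claim.}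 Then $$\underline d_{\rm TV}(\rho_n,\sigma_n)\ \lesssim\ \sqrt{1-\exp\big(-\underline D(\rho_n\|\sigma_n)\big)},$$ where $\exp(-\infty)=0$. -/

import Mathlib

open Filter Topology
open scoped ENNReal ComplexOrder

/-! ### Functions up to negligible differences

All quantities are nonnegative and possibly infinite, so functions of the scaling variable are taken
with values in `[0, ∞]`. -/

/-- The pseudodistance `d(f, g) = limsup_n exp (log |f n - g n| / log n)`, where the term with index `n`
is `0` if `f n = g n`.  In `[0, ∞]`, `|a - b|` is the sum of the two truncated differences. -/
noncomputable def asympDist (f g : ℕ → ℝ≥0∞) : ℝ≥0∞ :=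
  limsup (fun n : ℕ => if f n = g n then 0
    else ((f n - g n) + (g n - f n)) ^ (1 / Real.log (n : ℝ))) atTop

/-- `f ≲ g`: there is `h ≃ 0` (a negligible function) such that `f ≤ g + h`. -/
def NeglLE (f g : ℕ → ℝ≥0∞) : Prop :=
  ∃ h : ℕ → ℝ≥0∞, asympDist h 0 = 0 ∧ ∀ n, f n ≤ g n + h n

/-- `f` is (a representative of) the limit of `u` along `l` for the metric `asympDist`. -/
def IsNeglLim {α : Type*} (l : Filter α) (u : α → ℕ → ℝ≥0∞) (f : ℕ → ℝ≥0∞) : Prop :=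
  Tendsto (fun i => asympDist (u i) f) l (𝓝 0)

/-- `f` is (a representative of) the limit inferior of `u` along `l` for the order `≲`: it is a least
upper bound of all `a` such that eventually `a ≲ u i`. -/
def IsNeglLiminf {α : Type*} (l : Filter α) (u : α → ℕ → ℝ≥0∞) (f : ℕ → ℝ≥0∞) : Prop :=
  (∀ a : ℕ → ℝ≥0∞, (∀ᶠ i in l, NeglLE a (u i)) → NeglLE a f) ∧
  ∀ b : ℕ → ℝ≥0∞, (∀ a : ℕ → ℝ≥0∞, (∀ᶠ i in l, NeglLE a (u i)) → NeglLE a b) → NeglLE f b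

/-! ### Qubit registers

Operators on a register of qubits labelled by `ι` are matrices over the computational basis
`ι → Fin 2`. -/

/-- Operators on the qubit register `ι`. -/
abbrev QOp (ι : Type*) := Matrix (ι → Fin 2) (ι → Fin 2) ℂ

/-- Quantum states (density matrices). -/
def IsQState {ι : Type*} [Fintype ι] [DecidableEq ι] (ρ : QOp ι) : Prop :=
  ρ.PosSemidef ∧ ρ.trace = 1

/-- `ρ^{⊗ m}`; the qubit `(i, j)` is qubit `j` of copy `i`. -/
noncomputable def tensorPower {ι : Type*} (ρ : QOp ι) (m : ℕ) : QOp (Fin m × ι) :=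
  Matrix.of fun x y => ∏ i : Fin m, ρ (fun j => x (i, j)) (fun j => y (i, j))

/-- The tensor product `⨂ i, A i` of one-qubit operators. -/
noncomputable def tensorOp {ι : Type*} [Fintype ι] (A : ι → Matrix (Fin 2) (Fin 2) ℂ) : QOp ι :=
  Matrix.of fun x y => ∏ i, A i (x i) (y i)

/-- The projector `|0⟩⟨0|` of one qubit. -/
def proj0 : Matrix (Fin 2) (Fin 2) ℂ := Matrix.single 0 0 1

/-- `V` is a 2-local unitary acting on the set `S` of at most two qubits: `V = u_S ⊗ 𝟙`. -/
def IsTwoLocalGate {ι : Type*} [Fintype ι] [DecidableEq ι] (S : Finset ι) (V : QOp ι) : Prop :=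
  S.card ≤ 2 ∧ V ∈ Matrix.unitaryGroup (ι → Fin 2) ℂ ∧
    ∃ u : QOp S, ∀ x y : ι → Fin 2,
      V x y = if ∀ i, i ∉ S → x i = y i then u (fun i => x i) (fun i => y i) else 0

/-- The unitary realized by a circuit, a list of gates with the sets of qubits they act on. -/
noncomputable def circuitUnitary {ι : Type*} [Fintype ι] [DecidableEq ι]
    (L : List (Finset ι × QOp ι)) : QOp ι :=
  (L.map Prod.snd).prod

/-- `G`-complexity POVM effects `⟨0|_anc U (⨂ A_i) U† |0⟩_anc` on the register `ι`: there are any number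
`a` of ancillas, `U` is realized by a circuit of at most `G` arbitrary 2-local unitaries, and each `A_i`
is `|0⟩⟨0|` or `𝟙`, where a qubit that no gate acts on is not measured (`A_i = 𝟙`). -/
def effects (ι : Type*) [Fintype ι] [DecidableEq ι] (G : ℕ) : Set (QOp ι) :=
  {Λ | ∃ (a : ℕ) (L : List (Finset (Fin a ⊕ ι) × QOp (Fin a ⊕ ι)))
      (A : Fin a ⊕ ι → Matrix (Fin 2) (Fin 2) ℂ),
    (∀ g ∈ L, IsTwoLocalGate g.1 g.2) ∧ L.length ≤ G ∧
    (∀ i, A i = proj0 ∨ A i = 1) ∧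
    (∀ i, (∀ g ∈ L, i ∉ g.1) → A i = 1) ∧
    ∀ x y : ι → Fin 2, Λ x y =
      (circuitUnitary L * tensorOp A * (circuitUnitary L).conjTranspose)
        (Sum.elim 0 x) (Sum.elim 0 y)}

/-! ### Complexity-limited and computational quantities -/

/-- `d_TV(ρ, σ; G) = max_Λ Tr[Λ (ρ - σ)]` over `G`-complexity effects; the effect `𝟙` contributes `0`. -/
noncomputable def gateTV {ι : Type*} [Fintype ι] [DecidableEq ι] (ρ σ : QOp ι) (G : ℕ) : ℝ≥0∞ :=
  ⨆ Λ ∈ effects ι G, ENNReal.ofReal (Λ * (ρ - σ)).trace.re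

/-- The least type II error `min_Λ {Tr[Λ σ] | Tr[Λ ρ] ≥ 1 - ε}` over `G`-complexity effects. -/
noncomputable def gateTypeII {ι : Type*} [Fintype ι] [DecidableEq ι] (ε : ℝ) (ρ σ : QOp ι) (G : ℕ) :
    ℝ≥0∞ :=
  ⨅ Λ ∈ {Λ ∈ effects ι G | 1 - ε ≤ (Λ * ρ).trace.re}, ENNReal.ofReal (Λ * σ).trace.re

/-- `D_h^ε(ρ ‖ σ; G)`, minus the natural logarithm of the least type II error. -/
noncomputable def gateHypRelEntropy {ι : Type*} [Fintype ι] [DecidableEq ι] (ε : ℝ) (ρ σ : QOp ι)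
    (G : ℕ) : ℝ≥0∞ :=
  (-ENNReal.log (gateTypeII ε ρ σ G)).toENNReal

/-- `T` represents the computational total variation distance `lim_{ℓ→∞} d_TV(ρ_n, σ_n; n^ℓ)`. -/
def IsCompTV {N : ℕ → ℕ} (ρ σ : ∀ n, QOp (Fin (N n))) (T : ℕ → ℝ≥0∞) : Prop :=
  IsNeglLim atTop (fun ℓ n => gateTV (ρ n) (σ n) (n ^ ℓ)) T

/-- `D` represents the computational relative entropy
`lim_{ε→0} lim_{ℓ→∞} liminf_{k→∞} n^{-k} D_h^ε(ρ_n^{⊗ n^k} ‖ σ_n^{⊗ n^k}; n^{kℓ})`. -/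
def IsCompRelEntropy {N : ℕ → ℕ} (ρ σ : ∀ n, QOp (Fin (N n))) (D : ℕ → ℝ≥0∞) : Prop :=
  ∃ (M : ℝ → ℕ → ℝ≥0∞) (E : ℝ → ℕ → ℕ → ℝ≥0∞),
    IsNeglLim (𝓝[>] (0 : ℝ)) M D ∧
    ∀ᶠ ε in 𝓝[>] (0 : ℝ), IsNeglLim atTop (E ε) (M ε) ∧
      ∀ᶠ ℓ in atTop, IsNeglLiminf atTop
        (fun k n => gateHypRelEntropy ε (tensorPower (ρ n) (n ^ k)) (tensorPower (σ n) (n ^ k))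
          (n ^ (k * ℓ)) / (n : ℝ≥0∞) ^ k) (E ε ℓ)

/-! The inequality is reduced to its Bernoulli case by repeating one good test on many copies. Fix a
precision `x = n^{-(c+1)}` and an effect `Λ` with at most `n^{l₀}` gates whose advantage `t = p -
q`, with `p = Tr[Λρ]` and `q = Tr[Λσ]`, is within `x` of the distance at that complexity. On `m =
n^k` copies, apply `Λ` to each copy, count the failures, and accept if the success frequency is at
least `p - x/2`.

The outcomes are independent, so `chernoff_bound` applies to both errors. The type I error is at
most `(1 - (x/4)²)^m`, which tends to `0` once `k ≥ 2(c+1) + 1`. The type II error is at most `(1 -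
(t - x)²)^m`: the Chernoff exponent is a Bernoulli relative entropy, and `exp_neg_klBernoulli_le` is
the Bretagnolle–Huber bound for it. Hence the regularized hypothesis testing entropy is at least
`-log (1 - (t - x)²)` for `t > x`, and this passes to the limit inferior in `k` and then to `D` up
to `O(x²)`. Solving for `t` costs a square root, so the final error is `O(x)`.

The substantial part is that the collective test is an admissible effect of complexity `n^{kl}`.
Counting is a branching program with `(m+1)²` states, run reversibly with Toffoli gates on a one-hot
encoding (`exists_branching_circuit`, `exists_counting_effect`). Its cost is polynomial in `m` and
`n^{l₀}`, hence at most `m^5` for `k ≥ l₀` and large `n`, so every `l ≥ 5` suffices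
(`counting_cost_le`). -/

/-! ### Negligible differences as inverse polynomial bounds -/

theorem eventually_tsub_add_tsub_le_of_asympDist_lt {f g : ℕ → ℝ≥0∞} {c : ℕ}
    (h : asympDist f g < ENNReal.ofReal (Real.exp (-c))) :
    ∀ᶠ n : ℕ in atTop, (f n - g n) + (g n - f n) ≤ ((n : ℝ≥0∞)⁻¹) ^ c := by
  filter_upwards [eventually_lt_of_limsup_lt h, eventually_ge_atTop 2] with n hn h2
  by_cases hfg : f n = g n
  · simp [hfg]
  rw [if_neg hfg] at hn
  have h1 : (1 : ℝ) < n := by exact_mod_cast h2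
  have hlog : 0 < Real.log n := Real.log_pos h1
  -- Raising to the power `log n` cancels the exponent `1 / log n` and turns `e^{-c}` into `n^{-c}`.
  have key := ENNReal.rpow_le_rpow hn.le hlog.le
  rw [← ENNReal.rpow_mul, one_div_mul_cancel hlog.ne', ENNReal.rpow_one,
    ENNReal.ofReal_rpow_of_pos (Real.exp_pos _), ← Real.exp_mul] at key
  refine key.trans (le_of_eq ?_)
  have h3 : Real.exp (-(c : ℝ) * Real.log n) = ((n : ℝ)⁻¹) ^ c := by
    rw [neg_mul, Real.exp_neg, mul_comm, Real.exp_mul, Real.exp_log (by linarith),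
      Real.rpow_natCast, inv_pow]
  rw [h3, ENNReal.ofReal_pow (by positivity), ENNReal.ofReal_inv_of_pos (by linarith),
    ENNReal.ofReal_natCast]

theorem eventually_le_add_of_asympDist_lt {f g : ℕ → ℝ≥0∞} {c : ℕ}
    (h : asympDist f g < ENNReal.ofReal (Real.exp (-c))) :
    ∀ᶠ n : ℕ in atTop, f n ≤ g n + ((n : ℝ≥0∞)⁻¹) ^ c ∧ g n ≤ f n + ((n : ℝ≥0∞)⁻¹) ^ c := by
  filter_upwards [eventually_tsub_add_tsub_le_of_asympDist_lt h] with n hn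
  exact ⟨tsub_le_iff_left.1 (le_self_add.trans hn), tsub_le_iff_left.1 (le_add_self.trans hn)⟩

theorem asympDist_zero_eq_zero_of_eventually_le {h : ℕ → ℝ≥0∞}
    (hh : ∀ c : ℕ, ∀ᶠ n : ℕ in atTop, h n ≤ ((n : ℝ≥0∞)⁻¹) ^ c) : asympDist h 0 = 0 := by
  have key : ∀ c : ℕ, asympDist h 0 ≤ ENNReal.ofReal (Real.exp (-c)) := by
    intro c
    refine limsup_le_of_le (by isBoundedDefault) ?_
    filter_upwards [hh c, eventually_ge_atTop 2] with n hn h2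
    split_ifs with h0
    · simp
    have h1 : (1 : ℝ) < n := by exact_mod_cast h2
    have hlog : 0 < Real.log n := Real.log_pos h1
    simp only [Pi.zero_apply, tsub_zero, zero_tsub, add_zero]
    refine (ENNReal.rpow_le_rpow hn (by positivity)).trans (le_of_eq ?_)
    rw [← ENNReal.ofReal_natCast, ← ENNReal.ofReal_inv_of_pos (by linarith),
      ← ENNReal.ofReal_pow (by positivity), ENNReal.ofReal_rpow_of_pos (by positivity)]
    congr 1
    have h3 : ((n : ℝ)⁻¹) ^ c = Real.exp (Real.log n * (-c)) := by
      rw [Real.exp_mul, Real.exp_log (by linarith), Real.rpow_neg (by linarith),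
        Real.rpow_natCast, inv_pow]
    rw [h3, ← Real.exp_mul]
    congr 1
    field_simp
  refine le_antisymm (ge_of_tendsto' (x := atTop) ?_ key) zero_le
  rw [← ENNReal.ofReal_zero]
  exact (ENNReal.continuous_ofReal.tendsto 0).comp
    (Real.tendsto_exp_neg_atTop_nhds_zero.comp tendsto_natCast_atTop_atTop)

/-- Negligible means eventually below every inverse power of `n`; the truncated difference `f - g`
is the smallest possible error term, so it can serve as witness. -/
theorem neglLE_iff {f g : ℕ → ℝ≥0∞} :
    NeglLE f g ↔ ∀ c : ℕ, ∀ᶠ n : ℕ in atTop, f n ≤ g n + ((n : ℝ≥0∞)⁻¹) ^ c := by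
  constructor
  · rintro ⟨h, h0, hle⟩ c
    have hlt : asympDist h 0 < ENNReal.ofReal (Real.exp (-c)) := by
      rw [h0]; simpa using Real.exp_pos _
    filter_upwards [eventually_le_add_of_asympDist_lt hlt] with n hn
    refine (hle n).trans ?_
    gcongr
    simpa using hn.1
  · intro H
    refine ⟨fun n => f n - g n, asympDist_zero_eq_zero_of_eventually_le fun c => ?_,
      fun n => le_add_tsub⟩
    filter_upwards [H c] with n hn
    exact tsub_le_iff_left.2 hn

theorem eventually_asympDist_lt_exp {α : Type*} {l : Filter α} {u : α → ℕ → ℝ≥0∞}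
    {f : ℕ → ℝ≥0∞} (h : IsNeglLim l u f) (c : ℕ) :
    ∀ᶠ i in l, asympDist (u i) f < ENNReal.ofReal (Real.exp (-c)) :=
  h.eventually_lt_const (by simpa using Real.exp_pos _)

/-! ### Bernoulli relative entropy and large deviations -/

/-- After expanding the square, the cross term is `2 √(p(1-p)) √(q(1-q))`, and AM-GM bounds it by
`p(1-p) + q(1-q)`. -/
theorem bhattacharyya_sq_le {p q : ℝ} (hp0 : 0 ≤ p) (hp1 : p ≤ 1) (hq0 : 0 ≤ q) (hq1 : q ≤ 1) :
    (√(p * q) + √((1 - p) * (1 - q))) ^ 2 ≤ 1 - (p - q) ^ 2 := by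
  have h1 : √(p * q) ^ 2 = p * q := Real.sq_sqrt (by positivity)
  have h2 : √((1 - p) * (1 - q)) ^ 2 = (1 - p) * (1 - q) :=
    Real.sq_sqrt (mul_nonneg (by linarith) (by linarith))
  have h3 : √(p * q) * √((1 - p) * (1 - q)) = √(p * (1 - p)) * √(q * (1 - q)) := by
    rw [← Real.sqrt_mul (by positivity), ← Real.sqrt_mul (mul_nonneg hp0 (by linarith))]
    congr 1; ring
  have h4 : √(p * (1 - p)) ^ 2 = p * (1 - p) := Real.sq_sqrt (mul_nonneg hp0 (by linarith))
  have h5 : √(q * (1 - q)) ^ 2 = q * (1 - q) := Real.sq_sqrt (mul_nonneg hq0 (by linarith))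
  nlinarith [sq_nonneg (√(p * (1 - p)) - √(q * (1 - q)))]

/-- The Bretagnolle–Huber bound for two Bernoulli distributions, in exponentiated form. -/
theorem exp_neg_klBernoulli_le {p q : ℝ} (hp0 : 0 < p) (hp1 : p < 1) (hq0 : 0 < q) (hq1 : q < 1) :
    (q / p) ^ p * ((1 - q) / (1 - p)) ^ (1 - p) ≤ 1 - (p - q) ^ 2 := by
  have hp1' : 0 < 1 - p := by linarith
  have hq1' : 0 < 1 - q := by linarith
  -- Weighted AM-GM for the square roots of the likelihood ratios is Jensen's inequality: the
  -- relative entropy is at least `-2 log` of the Bhattacharyya coefficient.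
  have key := Real.geom_mean_le_arith_mean2_weighted hp0.le hp1'.le
    (Real.sqrt_nonneg (q / p)) (Real.sqrt_nonneg ((1 - q) / (1 - p))) (by ring)
  have e1 : ∀ a b : ℝ, 0 < a → 0 < b → a * √(b / a) = √(a * b) := by
    intro a b ha hb
    rw [Real.sqrt_div hb.le, Real.sqrt_mul ha.le, mul_div_assoc', div_eq_iff (by positivity)]
    rw [mul_right_comm, Real.mul_self_sqrt ha.le]
  rw [e1 p q hp0 hq0, e1 _ _ hp1' hq1'] at key
  refine le_trans ?_ (bhattacharyya_sq_le hp0.le hp1.le hq0.le hq1.le)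
  refine le_trans (le_of_eq ?_) (pow_le_pow_left₀ (by positivity) key 2)
  have e2 : ∀ a b : ℝ, 0 < a → (√a ^ b) ^ 2 = a ^ b := by
    intro a b ha
    rw [← Real.rpow_natCast, ← Real.rpow_mul (Real.sqrt_nonneg _), mul_comm, Real.rpow_mul
      (Real.sqrt_nonneg _), Real.rpow_natCast, Real.sq_sqrt ha.le]
  rw [mul_pow, e2 _ _ (by positivity), e2 _ _ (by positivity)]

/-- A Chernoff bound for `m` independent samples from `μ`. -/
theorem chernoff_bound {Z : Type*} [Fintype Z] (μ : Z → ℝ) (hμ : ∀ z, 0 ≤ μ z)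
    (hsum : ∑ z, μ z = 1) (S : Z → Prop) [DecidablePred S] {p q : ℝ} (hq : ∑ z, (if S z then μ z else 0) ≤ q)
    (hq0 : 0 < q) (hqp : q < p) (hp1 : p < 1) (m : ℕ) :
    ∑ z : Fin m → Z, (if (m : ℝ) * p ≤ (Finset.univ.filter fun i => S (z i)).card then
      ∏ i, μ (z i) else 0) ≤ (1 - (p - q) ^ 2) ^ m := by
  have hp0 : 0 < p := hq0.trans hqp
  have hp1' : 0 < 1 - p := by linarith
  have hq1' : 0 < 1 - q := by linarith
  -- The optimal tilt is the odds ratio of `p` and `q`; the indicator of the event is then dominated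
  -- by `x ^ (count - m p)`, which factorizes over the samples.
  set x : ℝ := (p * (1 - q)) / (q * (1 - p)) with hx
  have hx0 : 0 < x := by positivity
  have hx1 : 1 ≤ x := by
    rw [hx, one_le_div (by positivity)]; nlinarith
  have step1 : ∀ z : Fin m → Z,
      (if (m : ℝ) * p ≤ (Finset.univ.filter fun i => S (z i)).card then ∏ i, μ (z i) else 0)
        ≤ (∏ i, (μ (z i) * if S (z i) then x else 1)) * (x ^ p)⁻¹ ^ m := by
    intro z
    have hprod : ∏ i, (if S (z i) then x else (1 : ℝ))
        = x ^ (Finset.univ.filter fun i => S (z i)).card := by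
      rw [Finset.prod_ite, Finset.prod_const, Finset.prod_const_one, mul_one]
    have hnn : 0 ≤ ∏ i, μ (z i) := Finset.prod_nonneg fun i _ => hμ _
    rw [Finset.prod_mul_distrib, hprod, mul_assoc]
    split_ifs with h
    · refine le_mul_of_one_le_right hnn ?_
      rw [inv_pow, ← div_eq_mul_inv, one_le_div (by positivity), ← Real.rpow_mul_natCast hx0.le,
        ← Real.rpow_natCast]
      exact Real.rpow_le_rpow_of_exponent_le hx1 (by linarith)
    · positivity
  refine (Finset.sum_le_sum fun z _ => step1 z).trans ?_
  rw [← Finset.sum_mul, ← Fintype.sum_pow (fun z => μ z * if S z then x else 1) m, ← mul_pow]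
  refine pow_le_pow_left₀ (mul_nonneg (Finset.sum_nonneg fun z _ => mul_nonneg (hμ z) ?_)
    (by positivity)) ?_ m
  · split_ifs <;> positivity
  have hmean : ∑ z, (μ z * if S z then x else 1)
      = 1 + (∑ z, (if S z then μ z else 0)) * (x - 1) := by
    rw [Finset.sum_mul]
    refine Eq.trans ?_ (congrArg (· + _) hsum)
    rw [← Finset.sum_add_distrib]
    refine Finset.sum_congr rfl fun z _ => ?_
    split_ifs <;> ring
  have hle : ∑ z, (μ z * if S z then x else 1) ≤ (1 - q) / (1 - p) := by
    rw [hmean]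
    have : 1 + q * (x - 1) = (1 - q) / (1 - p) := by rw [hx]; field_simp; ring
    nlinarith
  refine (mul_le_mul_of_nonneg_right hle (by positivity)).trans
    (le_trans (le_of_eq ?_) (exp_neg_klBernoulli_le hp0 hp1 hq0 (by linarith)))
  have hx' : x = ((1 - q) / (1 - p)) / (q / p) := by rw [hx]; field_simp
  rw [hx', Real.div_rpow (by positivity) (by positivity), Real.rpow_sub (by positivity),
    Real.rpow_one]
  field_simp

/-! ### Matrices of functions and controlled one-qubit operations -/

section Gates

set_option linter.unusedSectionVars false

variable {κ : Type*} [Fintype κ] [DecidableEq κ]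

/-- An entry depends only on the labels in `S`, so the local factor can be read off with all other
qubits set to `0`. -/
theorem isTwoLocalGate_of_local {S : Finset κ} {V : QOp κ} (hS : S.card ≤ 2)
    (hV : V ∈ Matrix.unitaryGroup (κ → Fin 2) ℂ)
    (h0 : ∀ x y, V x y ≠ 0 → ∀ i, i ∉ S → x i = y i)
    (hloc : ∀ x y x' y', (∀ i, i ∉ S → x i = y i) → (∀ i, i ∉ S → x' i = y' i) →
      (∀ i ∈ S, x i = x' i) → (∀ i ∈ S, y i = y' i) → V x y = V x' y') :
    IsTwoLocalGate S V := by
  classical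
  refine ⟨hS, hV, Matrix.of fun x y => V (fun i => if h : i ∈ S then x ⟨i, h⟩ else 0)
    (fun i => if h : i ∈ S then y ⟨i, h⟩ else 0), fun x y => ?_⟩
  split_ifs with h
  · refine hloc _ _ _ _ h ?_ ?_ ?_ <;> intro i hi <;> simp [hi]
  · by_contra hne
    exact h (h0 x y hne)

theorem isTwoLocalGate_one {S : Finset κ} (hS : S.card ≤ 2) : IsTwoLocalGate S (1 : QOp κ) := by
  refine isTwoLocalGate_of_local hS (one_mem _) ?_ ?_
  · intro x y h i _
    rw [Matrix.one_apply] at h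
    simp_all
  · intro x y x' y' h h' hx hy
    rw [Matrix.one_apply, Matrix.one_apply]
    congr 1
    simp only [funext_iff, eq_iff_iff]
    constructor <;> intro H i <;> by_cases hi : i ∈ S
    · rw [← hx i hi, ← hy i hi, H]
    · exact h' i hi
    · rw [hx i hi, hy i hi, H]
    · exact h i hi

/-- The matrix sending the basis vector labelled `f x` to that labelled `x`. -/
def funMat (f : (κ → Fin 2) → κ → Fin 2) : QOp κ := Matrix.of fun x y => if y = f x then 1 else 0

theorem funMat_mul (f : (κ → Fin 2) → κ → Fin 2) (A : QOp κ) :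
    funMat f * A = Matrix.of fun x y => A (f x) y := by
  ext x y
  simp [funMat, Matrix.mul_apply]

/-- Labels are rows, so products compose from left to right: the first gate of a circuit acts first
on the label. -/
theorem funMat_mul_funMat (f g : (κ → Fin 2) → κ → Fin 2) :
    funMat f * funMat g = funMat (g ∘ f) := by
  rw [funMat_mul]; rfl

theorem funMat_id : funMat (id : (κ → Fin 2) → κ → Fin 2) = 1 := by
  ext x y
  simp [funMat, Matrix.one_apply, eq_comm]

theorem funMat_conjTranspose {f : (κ → Fin 2) → κ → Fin 2} (hf : Function.Involutive f) :
    (funMat f).conjTranspose = funMat f := by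
  ext x y
  have : x = f y ↔ y = f x := ⟨fun h => by rw [h, hf], fun h => by rw [h, hf]⟩
  simp [funMat, this, apply_ite]

theorem funMat_mem_unitary {f : (κ → Fin 2) → κ → Fin 2} (hf : Function.Involutive f) :
    funMat f ∈ Matrix.unitaryGroup (κ → Fin 2) ℂ := by
  rw [Matrix.mem_unitaryGroup_iff, Matrix.star_eq_conjTranspose, funMat_conjTranspose hf,
    funMat_mul_funMat, hf.comp_self, funMat_id]

theorem funMat_conj_apply {f : (κ → Fin 2) → κ → Fin 2} (hf : Function.Involutive f)
    (A : QOp κ) (x y : κ → Fin 2) : (funMat f * A * funMat f) x y = A (f x) (f y) := by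
  have : ∀ z, y = f z ↔ z = f y := fun z => ⟨fun h => by rw [h, hf], fun h => by rw [h, hf]⟩
  rw [funMat_mul, Matrix.mul_apply]
  simp [funMat, this]

/-- The operation that applies `v x` to the qubit `c`, where `x` is the basis label. -/
def ctlOp (c : κ) (v : (κ → Fin 2) → Matrix (Fin 2) (Fin 2) ℂ) : QOp κ :=
  Matrix.of fun x y => if ∀ i, i ≠ c → x i = y i then v x (x c) (y c) else 0

theorem sum_ite_agree_off_single (c : κ) (x : κ → Fin 2) (F : (κ → Fin 2) → ℂ) :
    ∑ z, (if ∀ i, i ≠ c → x i = z i then F z else 0) = ∑ t, F (Function.update x c t) := by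
  rw [← Finset.sum_filter]
  refine Finset.sum_nbij' (fun z => z c) (fun t => Function.update x c t) ?_ ?_ ?_ ?_ ?_
  · simp
  · intro t _
    simp only [Finset.mem_filter, Finset.mem_univ, true_and]
    intro i hi
    simp [hi]
  · intro z hz
    simp only [Finset.mem_filter, Finset.mem_univ, true_and] at hz
    ext i
    by_cases hi : i = c
    · subst hi; simp
    · simp [hi, hz i hi]
  · simp
  · intro z hz
    simp only [Finset.mem_filter, Finset.mem_univ, true_and] at hz
    congr 1
    ext i
    by_cases hi : i = c
    · subst hi; simp
    · simp [hi, hz i hi]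

theorem ctlOp_mul {c : κ} (v : (κ → Fin 2) → Matrix (Fin 2) (Fin 2) ℂ)
    {w : (κ → Fin 2) → Matrix (Fin 2) (Fin 2) ℂ} (hw : ∀ x t, w (Function.update x c t) = w x) :
    ctlOp c v * ctlOp c w = ctlOp c fun x => v x * w x := by
  ext x y
  rw [Matrix.mul_apply]
  simp only [ctlOp, Matrix.of_apply, ite_mul, zero_mul]
  rw [sum_ite_agree_off_single c x
    (fun z => v x (x c) (z c) * if ∀ i, i ≠ c → z i = y i then w z (z c) (y c) else 0)]
  have : ∀ t : Fin 2, (∀ i, i ≠ c → Function.update x c t i = y i) ↔ ∀ i, i ≠ c → x i = y i := by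
    intro t
    refine forall₂_congr fun i hi => ?_
    rw [Function.update_of_ne hi]
  simp only [this, Function.update_self, hw]
  split_ifs
  · rw [Matrix.mul_apply]
  · simp

theorem ctlOp_one (c : κ) : ctlOp c (fun _ => 1) = (1 : QOp κ) := by
  ext x y
  simp only [ctlOp, Matrix.of_apply, Matrix.one_apply]
  by_cases h : x = y
  · simp [h]
  · rw [if_neg h]
    split_ifs with h1 h2
    · exact absurd (funext fun i => if hi : i = c then hi ▸ h2 else h1 i hi) h
    · rfl
    · rfl

theorem ctlOp_conjTranspose {c : κ} {v : (κ → Fin 2) → Matrix (Fin 2) (Fin 2) ℂ}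
    (hv : ∀ x t, v (Function.update x c t) = v x) :
    (ctlOp c v).conjTranspose = ctlOp c fun x => (v x).conjTranspose := by
  ext x y
  simp only [ctlOp, Matrix.conjTranspose_apply, Matrix.of_apply]
  by_cases h : ∀ i, i ≠ c → x i = y i
  · have : v y = v x := by
      rw [← hv x (y c)]
      congr 1
      ext i
      by_cases hi : i = c
      · subst hi; simp
      · simp [hi, h i hi]
    rw [if_pos h, if_pos fun i hi => (h i hi).symm, this]
  · rw [if_neg h, if_neg fun H => h fun i hi => (H i hi).symm, star_zero]

theorem ctlOp_mem_unitary {c : κ} {v : (κ → Fin 2) → Matrix (Fin 2) (Fin 2) ℂ}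
    (hv : ∀ x t, v (Function.update x c t) = v x)
    (hu : ∀ x, v x ∈ Matrix.unitaryGroup (Fin 2) ℂ) :
    ctlOp c v ∈ Matrix.unitaryGroup (κ → Fin 2) ℂ := by
  rw [Matrix.mem_unitaryGroup_iff, Matrix.star_eq_conjTranspose, ctlOp_conjTranspose hv,
    ctlOp_mul _ fun x t => by rw [hv]]
  have : ∀ x, v x * (v x).conjTranspose = 1 := fun x => Matrix.mem_unitaryGroup_iff.1 (hu x)
  simp only [this, ctlOp_one]

theorem isTwoLocalGate_ctlOp {a c : κ} {v : Fin 2 → Matrix (Fin 2) (Fin 2) ℂ} (hac : a ≠ c)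
    (hu : ∀ s, v s ∈ Matrix.unitaryGroup (Fin 2) ℂ) :
    IsTwoLocalGate {a, c} (ctlOp c fun x => v (x a)) := by
  refine isTwoLocalGate_of_local Finset.card_le_two
    (ctlOp_mem_unitary (fun x t => by rw [Function.update_of_ne hac]) fun x => hu _) ?_ ?_
  · intro x y h i hi
    by_contra hne
    refine h ?_
    simp only [ctlOp, Matrix.of_apply]
    rw [if_neg]
    intro H
    exact hne (H i fun hc => hi (by simp [hc]))
  · intro x y x' y' h h' hx hy
    simp only [ctlOp, Matrix.of_apply]
    rw [hx a (by simp), hx c (by simp), hy c (by simp)]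
    congr 1
    simp only [eq_iff_iff]
    refine forall₂_congr fun i hi => ?_
    by_cases hia : i = a
    · subst hia; rw [hx i (by simp), hy i (by simp)]
    · exact iff_of_true (h i (by simp [hi, hia])) (h' i (by simp [hi, hia]))

/-! ### Reversible gates and the Toffoli decomposition -/

/-- Flip the qubit `c`. -/
def flipFun (c : κ) (x : κ → Fin 2) : κ → Fin 2 := Function.update x c (x c + 1)

theorem flipFun_involutive (c : κ) : Function.Involutive (flipFun c) := by
  intro x
  ext i
  by_cases hi : i = c
  · subst hi
    simp only [flipFun, Function.update_self]
    generalize x i = s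
    fin_cases s <;> rfl
  · simp [flipFun, hi]

theorem isTwoLocalGate_flipFun (c : κ) : IsTwoLocalGate {c} (funMat (flipFun c)) := by
  refine isTwoLocalGate_of_local (by simp) (funMat_mem_unitary (flipFun_involutive c)) ?_ ?_
  · intro x y h i hi
    have hy : y = flipFun c x := by
      by_contra hne
      exact h (by simp [funMat, hne])
    rw [hy, flipFun, Function.update_of_ne (by simpa using hi)]
  · intro x y x' y' h h' hx hy
    simp only [funMat, Matrix.of_apply]
    congr 1
    simp only [flipFun, Function.eq_update_iff, eq_iff_iff]
    rw [hx c (by simp), hy c (by simp)]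
    exact and_congr_right fun _ => iff_of_true (fun i hi => (h i (by simpa using hi)).symm)
      fun i hi => (h' i (by simpa using hi)).symm

/-- Add the qubit `a` to the qubit `b` (a controlled not). -/
def cnotFun (a b : κ) (x : κ → Fin 2) : κ → Fin 2 := Function.update x b (x b + x a)

theorem cnotFun_involutive {a b : κ} (hab : a ≠ b) : Function.Involutive (cnotFun a b) := by
  intro x
  ext i
  by_cases hi : i = b
  · subst hi
    simp only [cnotFun, Function.update_self, Function.update_of_ne hab]
    generalize x i = s
    generalize x a = t
    fin_cases s <;> fin_cases t <;> rfl
  · simp [cnotFun, hi]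

theorem isTwoLocalGate_cnotFun {a b : κ} (hab : a ≠ b) :
    IsTwoLocalGate {a, b} (funMat (cnotFun a b)) := by
  refine isTwoLocalGate_of_local Finset.card_le_two
    (funMat_mem_unitary (cnotFun_involutive hab)) ?_ ?_
  · intro x y h i hi
    have hy : y = cnotFun a b x := by
      by_contra hne
      exact h (by simp [funMat, hne])
    rw [hy, cnotFun, Function.update_of_ne (by simp at hi; tauto)]
  · intro x y x' y' h h' hx hy
    simp only [funMat, Matrix.of_apply]
    congr 1
    simp only [cnotFun, Function.eq_update_iff, eq_iff_iff]
    rw [hx b (by simp), hx a (by simp), hy b (by simp)]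
    refine and_congr_right fun _ => forall₂_congr fun i hi => ?_
    by_cases hia : i = a
    · subst hia; rw [hx i (by simp), hy i (by simp)]
    · exact iff_of_true (h i (by simp [hi, hia])).symm (h' i (by simp [hi, hia])).symm

/-- Flip the qubit `c` if the qubit `a` is `1` and the qubit `b` is `β`. -/
def toffoliFun (β : Fin 2) (a b c : κ) (x : κ → Fin 2) : κ → Fin 2 :=
  if x a = 1 ∧ x b = β then flipFun c x else x

/-- The Pauli matrix `X`. -/
def pauliX : Matrix (Fin 2) (Fin 2) ℂ := !![0, 1; 1, 0]

/-- A square root of the Pauli matrix `X`. -/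
noncomputable def sqrtPauliX : Matrix (Fin 2) (Fin 2) ℂ :=
  !![(1 + Complex.I) / 2, (1 - Complex.I) / 2; (1 - Complex.I) / 2, (1 + Complex.I) / 2]

theorem sqrtPauliX_mul_self : sqrtPauliX * sqrtPauliX = pauliX := by
  have := Complex.I_sq
  ext i j
  fin_cases i <;> fin_cases j <;> simp [sqrtPauliX, pauliX, Matrix.mul_apply, Fin.sum_univ_two] <;>
    ring_nf <;> rw [this] <;> ring

theorem sqrtPauliX_mul_conjTranspose : sqrtPauliX * sqrtPauliX.conjTranspose = 1 := by
  have := Complex.I_sq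
  ext i j
  fin_cases i <;> fin_cases j <;>
    simp [sqrtPauliX, Matrix.mul_apply, Fin.sum_univ_two, Complex.conj_ofNat] <;>
    ring_nf <;> rw [this] <;> ring

theorem sqrtPauliX_mem_unitary : sqrtPauliX ∈ Matrix.unitaryGroup (Fin 2) ℂ :=
  Matrix.mem_unitaryGroup_iff.2 sqrtPauliX_mul_conjTranspose

theorem conjTranspose_mul_sqrtPauliX : sqrtPauliX.conjTranspose * sqrtPauliX = 1 :=
  Matrix.mem_unitaryGroup_iff'.1 sqrtPauliX_mem_unitary

theorem sqrtPauliX_conjTranspose_mem_unitary :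
    sqrtPauliX.conjTranspose ∈ Matrix.unitaryGroup (Fin 2) ℂ :=
  Matrix.mem_unitaryGroup_iff.2 (by
    rw [Matrix.star_eq_conjTranspose, Matrix.conjTranspose_conjTranspose,
      conjTranspose_mul_sqrtPauliX])

theorem funMat_toffoliFun_eq_ctlOp (β : Fin 2) (a b c : κ) :
    funMat (toffoliFun β a b c) = ctlOp c fun x => if x a = 1 ∧ x b = β then pauliX else 1 := by
  ext x y
  by_cases h : x a = 1 ∧ x b = β
  · have hX : (if x a = 1 ∧ x b = β then pauliX else 1) = pauliX := if_pos h
    have hT : toffoliFun β a b c x = Function.update x c (x c + 1) := if_pos h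
    simp only [funMat, ctlOp, Matrix.of_apply, hT, Function.eq_update_iff]
    rw [hX]
    by_cases h2 : ∀ i, i ≠ c → x i = y i
    · rw [if_pos h2]
      have : (∀ i, i ≠ c → y i = x i) := fun i hi => (h2 i hi).symm
      have hval : ∀ s t : Fin 2, pauliX s t = if t = s + 1 then 1 else 0 := by
        intro s t
        fin_cases s <;> fin_cases t <;> simp [pauliX]
      rw [hval]
      by_cases hy : y c = x c + 1
      · rw [if_pos ⟨hy, this⟩, if_pos hy]
      · rw [if_neg fun H => hy H.1, if_neg hy]
    · rw [if_neg h2, if_neg fun H => h2 fun i hi => (H.2 i hi).symm]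
  · have hX : (if x a = 1 ∧ x b = β then pauliX else 1) = 1 := if_neg h
    have hT : toffoliFun β a b c x = x := if_neg h
    simp only [funMat, ctlOp, Matrix.of_apply, hT]
    rw [hX]
    have := congrFun (congrFun (ctlOp_one c) x) y
    simp only [ctlOp, Matrix.of_apply] at this
    rw [this, Matrix.one_apply]
    simp [eq_comm]

/-- The circuit of Sleator and Weinfurter for the Toffoli gate. -/
noncomputable def toffoliCircuit (β : Fin 2) (a b c : κ) : List (Finset κ × QOp κ) :=
  [({b, c}, ctlOp c fun x => if x b = β then sqrtPauliX else 1),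
   ({a, b}, funMat (cnotFun a b)),
   ({b, c}, ctlOp c fun x => if x b = β then sqrtPauliX.conjTranspose else 1),
   ({a, b}, funMat (cnotFun a b)),
   ({a, c}, ctlOp c fun x => if x a = 1 then sqrtPauliX else 1)]

theorem toffoliCircuit_twoLocal (β : Fin 2) {a b c : κ} (hab : a ≠ b) (hac : a ≠ c) (hbc : b ≠ c) :
    ∀ g ∈ toffoliCircuit β a b c, IsTwoLocalGate g.1 g.2 := by
  have h1 : ∀ (β : Fin 2), ∀ s : Fin 2, (if s = β then sqrtPauliX else 1)
      ∈ Matrix.unitaryGroup (Fin 2) ℂ := fun β s => by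
    split_ifs
    exacts [sqrtPauliX_mem_unitary, one_mem _]
  have h2 : ∀ s : Fin 2, (if s = β then sqrtPauliX.conjTranspose else 1)
      ∈ Matrix.unitaryGroup (Fin 2) ℂ := fun s => by
    split_ifs
    exacts [sqrtPauliX_conjTranspose_mem_unitary, one_mem _]
  intro g hg
  simp only [toffoliCircuit, List.mem_cons, List.not_mem_nil, or_false] at hg
  rcases hg with rfl | rfl | rfl | rfl | rfl
  · exact isTwoLocalGate_ctlOp (v := fun s => if s = β then sqrtPauliX else 1) hbc (h1 β)
  · exact isTwoLocalGate_cnotFun hab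
  · exact isTwoLocalGate_ctlOp (v := fun s => if s = β then sqrtPauliX.conjTranspose else 1) hbc h2
  · exact isTwoLocalGate_cnotFun hab
  · exact isTwoLocalGate_ctlOp (v := fun s => if s = 1 then sqrtPauliX else 1) hac (h1 1)

/-- Conjugation by the controlled not replaces a control by the qubit `b` with a control by the
parity of `a` and `b`. -/
theorem funMat_conj_ctlOp {a b c : κ} (hab : a ≠ b) (hac : a ≠ c) (hbc : b ≠ c)
    (v : (κ → Fin 2) → Matrix (Fin 2) (Fin 2) ℂ) :
    funMat (cnotFun a b) * ctlOp c v * funMat (cnotFun a b)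
      = ctlOp c fun x => v (cnotFun a b x) := by
  ext x y
  rw [funMat_conj_apply (cnotFun_involutive hab)]
  simp only [ctlOp, Matrix.of_apply]
  have hc : ∀ x : κ → Fin 2, cnotFun a b x c = x c := fun x => by
    rw [cnotFun, Function.update_of_ne hbc.symm]
  have key : ∀ x y : κ → Fin 2, (∀ i, i ≠ c → x i = y i) →
      ∀ i, i ≠ c → cnotFun a b x i = cnotFun a b y i := by
    intro x y h i hi
    simp only [cnotFun, Function.update_apply]
    rw [h i hi, h a hac, h b hbc]
  have hiff : (∀ i, i ≠ c → cnotFun a b x i = cnotFun a b y i) ↔ ∀ i, i ≠ c → x i = y i := by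
    refine ⟨fun h => ?_, key x y⟩
    have := key _ _ h
    rwa [cnotFun_involutive hab, cnotFun_involutive hab] at this
  simp only [hiff, hc]

theorem circuitUnitary_toffoliCircuit (β : Fin 2) {a b c : κ} (hab : a ≠ b) (hac : a ≠ c)
    (hbc : b ≠ c) :
    circuitUnitary (toffoliCircuit β a b c) = funMat (toffoliFun β a b c) := by
  have h1 : ∀ (x : κ → Fin 2) t, cnotFun a b (Function.update x c t) b = cnotFun a b x b := by
    intro x t
    simp [cnotFun, hac, hbc]
  rw [circuitUnitary, toffoliCircuit, funMat_toffoliFun_eq_ctlOp]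
  simp only [List.map_cons, List.map_nil, List.prod_cons, List.prod_nil, mul_one]
  rw [← mul_assoc (funMat _) (ctlOp _ _), ← mul_assoc (_ * _) (funMat _),
    funMat_conj_ctlOp hab hac hbc,
    ctlOp_mul _ fun x t => by simp [hac], ctlOp_mul _ fun x t => by simp [h1, hac]]
  congr 1
  ext1 x
  have h2 : cnotFun a b x b = x b + x a := by simp [cnotFun]
  rw [h2]
  generalize x a = s
  generalize x b = t
  have e1 := sqrtPauliX_mul_self
  have e2 := sqrtPauliX_mul_conjTranspose
  have e3 := conjTranspose_mul_sqrtPauliX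
  -- With `V = sqrtPauliX`, the target receives `V^[b=β] V†^[a+b=β] V^[a=1]`. For `a = 0` the first
  -- two factors cancel; for `a = 1` the product is `V² = X` if `b = β` and `V†V = 1` otherwise.
  fin_cases s <;> fin_cases t <;> fin_cases β <;> simp [e1, e2, e3]

end Gates

/-! ### Operators and circuits on part of a register -/

section Lift

set_option linter.unusedSectionVars false

variable {κ κ' : Type*} [Fintype κ] [DecidableEq κ] [Fintype κ'] [DecidableEq κ']

open Classical in
/-- The operator `V` acting on the qubits in the range of `e`. -/
noncomputable def liftOp (e : κ ↪ κ') (V : QOp κ) : QOp κ' :=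
  Matrix.of fun x y => if ∀ i, i ∉ Set.range e → x i = y i then V (x ∘ e) (y ∘ e) else 0

theorem extend_comp_embedding {α : Type*} (e : κ ↪ κ') (w : κ → α) (x : κ' → α) :
    Function.extend e w x ∘ e = w :=
  funext fun i => e.injective.extend_apply w x i

theorem extend_comp_self {α : Type*} (e : κ ↪ κ') (x y : κ' → α)
    (h : ∀ i, i ∉ Set.range e → x i = y i) : Function.extend e (y ∘ e) x = y := by
  ext i
  by_cases hi : i ∈ Set.range e
  · obtain ⟨j, rfl⟩ := hi
    rw [e.injective.extend_apply]; rfl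
  · rw [Function.extend_apply' _ _ _ hi, h i hi]

open Classical in
theorem sum_ite_agree_off_range (e : κ ↪ κ') (x : κ' → Fin 2) (F : (κ' → Fin 2) → ℂ) :
    ∑ z, (if ∀ i, i ∉ Set.range e → x i = z i then F z else 0)
      = ∑ w : κ → Fin 2, F (Function.extend e w x) := by
  rw [← Finset.sum_filter]
  refine Finset.sum_nbij' (fun z => z ∘ e) (fun w => Function.extend e w x) ?_ ?_ ?_ ?_ ?_
  · simp
  · intro w _
    simp only [Finset.mem_filter, Finset.mem_univ, true_and]
    intro i hi
    rw [Function.extend_apply' _ _ _ hi]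
  · intro z hz
    simp only [Finset.mem_filter, Finset.mem_univ, true_and] at hz
    exact extend_comp_self e x z hz
  · intro w _
    exact extend_comp_embedding e w x
  · intro z hz
    simp only [Finset.mem_filter, Finset.mem_univ, true_and] at hz
    rw [extend_comp_self e x z hz]

theorem liftOp_mul_apply (e : κ ↪ κ') (V : QOp κ) (B : QOp κ') (x y : κ' → Fin 2) :
    (liftOp e V * B) x y = ∑ w : κ → Fin 2, V (x ∘ e) w * B (Function.extend e w x) y := by
  classical
  have h := sum_ite_agree_off_range e x fun z => V (x ∘ e) (z ∘ e) * B z y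
  simp only [extend_comp_embedding] at h
  rw [← h, Matrix.mul_apply]
  refine Finset.sum_congr rfl fun z _ => ?_
  simp only [liftOp, Matrix.of_apply, ite_mul, zero_mul]

theorem liftOp_mul (e : κ ↪ κ') (V W : QOp κ) :
    liftOp e (V * W) = liftOp e V * liftOp e W := by
  classical
  ext x y
  rw [liftOp_mul_apply]
  have hiff : ∀ w : κ → Fin 2, (∀ i, i ∉ Set.range e → Function.extend e w x i = y i) ↔
      ∀ i, i ∉ Set.range e → x i = y i := fun w => forall₂_congr fun i hi => by
    rw [Function.extend_apply' _ _ _ hi]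
  simp only [liftOp, Matrix.of_apply, extend_comp_embedding, hiff]
  split_ifs
  · rw [Matrix.mul_apply]
  · simp

theorem liftOp_one (e : κ ↪ κ') : liftOp e (1 : QOp κ) = 1 := by
  classical
  ext x y
  simp only [liftOp, Matrix.of_apply, Matrix.one_apply]
  by_cases h : x = y
  · simp [h]
  · rw [if_neg h]
    split_ifs with h1 h2
    · rw [← extend_comp_self e x y h1, ← h2, extend_comp_self e x x fun _ _ => rfl] at h
      exact absurd rfl h
    · rfl
    · rfl

theorem liftOp_conjTranspose (e : κ ↪ κ') (V : QOp κ) :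
    (liftOp e V).conjTranspose = liftOp e V.conjTranspose := by
  classical
  ext x y
  simp only [liftOp, Matrix.conjTranspose_apply, Matrix.of_apply, apply_ite star, star_zero]
  simp only [eq_comm]

theorem liftOp_mem_unitary (e : κ ↪ κ') {V : QOp κ}
    (hV : V ∈ Matrix.unitaryGroup (κ → Fin 2) ℂ) :
    liftOp e V ∈ Matrix.unitaryGroup (κ' → Fin 2) ℂ := by
  rw [Matrix.mem_unitaryGroup_iff, Matrix.star_eq_conjTranspose, liftOp_conjTranspose,
    ← liftOp_mul, ← Matrix.star_eq_conjTranspose, Matrix.mem_unitaryGroup_iff.1 hV, liftOp_one]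

theorem IsTwoLocalGate.lift (e : κ ↪ κ') {S : Finset κ} {V : QOp κ} (h : IsTwoLocalGate S V) :
    IsTwoLocalGate (S.map e) (liftOp e V) := by
  classical
  obtain ⟨hS, hV, u, hu⟩ := h
  have hoff : ∀ x y : κ' → Fin 2, (∀ i, i ∉ S.map e → x i = y i) →
      (∀ j, j ∉ S → (x ∘ e) j = (y ∘ e) j) := fun x y hxy j hj => hxy _ (by simpa using hj)
  have hoff' : ∀ x y : κ' → Fin 2, (∀ i, i ∉ S.map e → x i = y i) →
      (∀ i, i ∉ Set.range e → x i = y i) := fun x y hxy i hi => hxy i fun H => hi (by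
    obtain ⟨j, _, rfl⟩ := Finset.mem_map.1 H
    exact ⟨j, rfl⟩)
  refine isTwoLocalGate_of_local (by rwa [Finset.card_map]) (liftOp_mem_unitary e hV) ?_ ?_
  · intro x y hne i hi
    simp only [liftOp, Matrix.of_apply] at hne
    split_ifs at hne with h1
    · by_cases hr : i ∈ Set.range e
      · obtain ⟨j, rfl⟩ := hr
        rw [hu] at hne
        split_ifs at hne with h2
        · exact h2 j (by simpa using hi)
        · exact absurd rfl hne
      · exact h1 i hr
    · exact absurd rfl hne
  · intro x y x' y' hxy hxy' hx hy
    simp only [liftOp, Matrix.of_apply]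
    rw [if_pos (hoff' _ _ hxy), if_pos (hoff' _ _ hxy'), hu, hu, if_pos (hoff _ _ hxy),
      if_pos (hoff _ _ hxy')]
    congr 1 <;> ext1 i
    · exact hx _ (Finset.mem_map_of_mem e i.2)
    · exact hy _ (Finset.mem_map_of_mem e i.2)

/-- The circuit `L` acting on the qubits in the range of `e`. -/
noncomputable def liftCircuit (e : κ ↪ κ') (L : List (Finset κ × QOp κ)) :
    List (Finset κ' × QOp κ') :=
  L.map fun g => (g.1.map e, liftOp e g.2)

theorem circuitUnitary_append (L L' : List (Finset κ × QOp κ)) :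
    circuitUnitary (L ++ L') = circuitUnitary L * circuitUnitary L' := by
  simp [circuitUnitary]

theorem circuitUnitary_flatMap {I : Type*} (l : List I) (F : I → List (Finset κ × QOp κ)) :
    circuitUnitary (l.flatMap F) = (l.map fun i => circuitUnitary (F i)).prod := by
  induction l with
  | nil => simp [circuitUnitary]
  | cons i l ih => rw [List.flatMap_cons, circuitUnitary_append, ih, List.map_cons, List.prod_cons]

theorem circuitUnitary_liftCircuit (e : κ ↪ κ') (L : List (Finset κ × QOp κ)) :
    circuitUnitary (liftCircuit e L) = liftOp e (circuitUnitary L) := by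
  induction L with
  | nil => simp [circuitUnitary, liftCircuit, liftOp_one]
  | cons g L ih =>
    simp only [circuitUnitary, liftCircuit, List.map_cons, List.prod_cons, liftOp_mul] at ih ⊢
    rw [ih]

theorem liftCircuit_twoLocal (e : κ ↪ κ') {L : List (Finset κ × QOp κ)}
    (hL : ∀ g ∈ L, IsTwoLocalGate g.1 g.2) : ∀ g ∈ liftCircuit e L, IsTwoLocalGate g.1 g.2 := by
  intro g hg
  obtain ⟨g', hg', rfl⟩ := List.mem_map.1 hg
  exact (hL g' hg').lift e

theorem circuitUnitary_mem_unitary {L : List (Finset κ × QOp κ)}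
    (hL : ∀ g ∈ L, IsTwoLocalGate g.1 g.2) :
    circuitUnitary L ∈ Matrix.unitaryGroup (κ → Fin 2) ℂ := by
  refine list_prod_mem fun V hV => ?_
  obtain ⟨g, hg, rfl⟩ := List.mem_map.1 hV
  exact (hL g hg).2.1

-- Operators on disjoint blocks multiply to a tensor product. In the inductive step the later
-- factors leave the block `i` unchanged, so only the intermediate label that already agrees with
-- `y` there contributes.
open Classical in
theorem prod_liftOp_apply {I : Type*} (e : I → κ ↪ κ')
    (he : ∀ i j k k', e i k = e j k' → i = j) (U : QOp κ) {l : List I} (hl : l.Nodup)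
    (x y : κ' → Fin 2) :
    (l.map fun i => liftOp (e i) U).prod x y
      = if ∀ c, (∀ i ∈ l, c ∉ Set.range (e i)) → x c = y c then
          (l.map fun i => U (x ∘ e i) (y ∘ e i)).prod else 0 := by
  induction l generalizing x with
  | nil =>
    simp only [List.map_nil, List.prod_nil, Matrix.one_apply, List.not_mem_nil, false_imp_iff,
      implies_true, true_imp_iff, funext_iff]
  | cons i l ih =>
    obtain ⟨hil, hl⟩ := List.nodup_cons.1 hl
    have hdisj : ∀ j ∈ l, ∀ k, e i k ∉ Set.range (e j) := by
      rintro j hj k ⟨k', hk'⟩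
      exact hil (he _ _ _ _ hk' ▸ hj)
    rw [List.map_cons, List.prod_cons, liftOp_mul_apply,
      Finset.sum_eq_single (y ∘ e i)]
    · rw [ih hl]
      have hcomp : ∀ j ∈ l, Function.extend (e i) (y ∘ e i) x ∘ e j = x ∘ e j := by
        intro j hj
        ext1 k
        refine Function.extend_apply' _ _ _ ?_
        rintro ⟨k', hk'⟩
        exact hdisj j hj k' ⟨k, hk'.symm⟩
      have hiff : (∀ c, (∀ j ∈ l, c ∉ Set.range (e j)) →
          Function.extend (e i) (y ∘ e i) x c = y c) ↔
          ∀ c, (∀ j ∈ i :: l, c ∉ Set.range (e j)) → x c = y c := by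
        constructor
        · intro H c hc
          rw [← H c fun j hj => hc j (List.mem_cons_of_mem _ hj),
            Function.extend_apply' _ _ _ (hc i List.mem_cons_self)]
        · intro H c hc
          by_cases hci : c ∈ Set.range (e i)
          · obtain ⟨k, rfl⟩ := hci
            rw [(e i).injective.extend_apply]; rfl
          · rw [Function.extend_apply' _ _ _ hci]
            refine H c fun j hj => ?_
            rcases List.mem_cons.1 hj with rfl | hj
            exacts [hci, hc j hj]
      have hmap : (l.map fun j => U (Function.extend (e i) (y ∘ e i) x ∘ e j) (y ∘ e j))
          = l.map fun j => U (x ∘ e j) (y ∘ e j) :=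
        List.map_congr_left fun j hj => by rw [hcomp j hj]
      rw [if_congr hiff rfl rfl, hmap, List.map_cons, List.prod_cons, mul_ite, mul_zero]
    · intro w _ hw
      rw [ih hl, if_neg, mul_zero]
      intro H
      refine hw (funext fun k => ?_)
      have := H (e i k) fun j hj => hdisj j hj k
      rwa [(e i).injective.extend_apply] at this
    · intro h
      exact absurd (Finset.mem_univ _) h

end Lift

/-! ### Effects with an arbitrary ancilla register -/

theorem proj0_ne_one : proj0 ≠ 1 := by
  intro h
  have := congrFun (congrFun h 1) 1
  simp [proj0] at this

open Classical in
theorem tensorOp_eq_diagonal {κ : Type*} [Fintype κ] {A : κ → Matrix (Fin 2) (Fin 2) ℂ}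
    (hA : ∀ i, A i = proj0 ∨ A i = 1) :
    tensorOp A = Matrix.diagonal fun z => if ∀ i, A i = proj0 → z i = 0 then 1 else 0 := by
  ext x y
  simp only [tensorOp, Matrix.of_apply, Matrix.diagonal_apply]
  have hoff : ∀ i, x i ≠ y i → A i (x i) (y i) = 0 := by
    intro i hi
    rcases hA i with h | h
    · rw [h, proj0, Matrix.single_apply, if_neg]
      rintro ⟨h1, h2⟩
      exact hi (h1 ▸ h2)
    · rw [h, Matrix.one_apply_ne hi]
  split_ifs with h1 h2
  · subst h1
    refine Finset.prod_eq_one fun i _ => ?_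
    rcases hA i with h | h
    · rw [h2 i h, h]; simp [proj0]
    · rw [h, Matrix.one_apply_eq]
  · subst h1
    push Not at h2
    obtain ⟨i, hi, hne⟩ := h2
    refine Finset.prod_eq_zero (Finset.mem_univ i) ?_
    rw [hi, proj0, Matrix.single_apply, if_neg]
    rintro ⟨h, -⟩
    exact hne h.symm
  · obtain ⟨i, hi⟩ := Function.ne_iff.1 h1
    exact Finset.prod_eq_zero (Finset.mem_univ i) (hoff i hi)

/-- Ancillas labelled by any finite type may be used, and measured qubits need not be acted on if
their number is added to the number of gates. -/
theorem mem_effects_of_circuit {α ι : Type*} [Fintype α] [DecidableEq α] [Fintype ι]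
    [DecidableEq ι] {G : ℕ} {L : List (Finset (α ⊕ ι) × QOp (α ⊕ ι))}
    (hL : ∀ g ∈ L, IsTwoLocalGate g.1 g.2) (R : Finset (α ⊕ ι)) (hG : L.length + R.card ≤ G)
    {Λ : QOp ι} (hΛ : ∀ x y, Λ x y =
      (circuitUnitary L * tensorOp (fun i => if i ∈ R then proj0 else 1) *
        (circuitUnitary L).conjTranspose) (Sum.elim 0 x) (Sum.elim 0 y)) :
    Λ ∈ effects ι G := by
  classical
  let e : α ⊕ ι ≃ Fin (Fintype.card α) ⊕ ι := (Fintype.equivFin α).sumCongr (Equiv.refl ι)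
  let e' : α ⊕ ι ↪ Fin (Fintype.card α) ⊕ ι := e.toEmbedding
  let A : α ⊕ ι → Matrix (Fin 2) (Fin 2) ℂ := fun i => if i ∈ R then proj0 else 1
  have hidle : ∀ l : List (α ⊕ ι),
      circuitUnitary (l.map fun i => (({i} : Finset (α ⊕ ι)), (1 : QOp (α ⊕ ι)))) = 1 := by
    intro l
    rw [circuitUnitary, List.map_map]
    exact List.prod_eq_one fun V hV => by
      obtain ⟨i, -, rfl⟩ := List.mem_map.1 hV
      rfl
  have hequiv : ∀ V : QOp (α ⊕ ι), ∀ x y, liftOp e' V x y = V (x ∘ e) (y ∘ e) := by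
    intro V x y
    simp only [liftOp, Matrix.of_apply]
    rw [if_pos]
    · rfl
    · intro i hi
      exact absurd ⟨e.symm i, e.apply_symm_apply i⟩ hi
  have hten : tensorOp (A ∘ e.symm) = liftOp e' (tensorOp A) := by
    ext x y
    rw [hequiv]
    simp only [tensorOp, Matrix.of_apply]
    exact Fintype.prod_equiv e.symm _ _ fun i => by simp
  have helim : ∀ x : ι → Fin 2, (Sum.elim 0 x : Fin (Fintype.card α) ⊕ ι → Fin 2) ∘ e
      = (Sum.elim 0 x : α ⊕ ι → Fin 2) := by
    intro x
    ext i
    rcases i with i | i <;> rfl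
  -- An identity gate on each qubit of `R` makes it count as acted on without changing the unitary.
  refine ⟨Fintype.card α, liftCircuit e' (L ++ R.toList.map fun i => ({i}, 1)), A ∘ e.symm,
    liftCircuit_twoLocal e' ?_, ?_, fun i => ?_, fun i hi => ?_, fun x y => ?_⟩
  · intro g hg
    rcases List.mem_append.1 hg with hg | hg
    · exact hL g hg
    · obtain ⟨i, -, rfl⟩ := List.mem_map.1 hg
      exact isTwoLocalGate_one (by simp)
  · simpa [liftCircuit] using hG
  · simp only [A, Function.comp_apply]
    split_ifs <;> simp
  · simp only [A, Function.comp_apply]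
    rw [if_neg]
    intro hR
    refine hi (Finset.map e' {e.symm i}, liftOp e' 1) ?_ ?_
    · refine List.mem_map.2 ⟨({e.symm i}, 1), ?_, rfl⟩
      exact List.mem_append.2 (Or.inr (List.mem_map.2 ⟨_, Finset.mem_toList.2 hR, rfl⟩))
    · simp [e']
  · rw [hΛ, circuitUnitary_liftCircuit, circuitUnitary_append, hidle, mul_one, hten,
      liftOp_conjTranspose, ← liftOp_mul, ← liftOp_mul, hequiv, helim, helim]

/-! ### Circuits for branching programs -/

section Branching

set_option linter.unusedSectionVars false

variable {κ σ : Type*} [Fintype κ] [DecidableEq κ] [Fintype σ] [DecidableEq σ]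

theorem injective_of_funMat_mem_unitary {f : (κ → Fin 2) → κ → Fin 2}
    (hf : funMat f ∈ Matrix.unitaryGroup (κ → Fin 2) ℂ) : Function.Injective f := by
  intro x y hxy
  have h := congrFun (congrFun (Matrix.mem_unitaryGroup_iff.1 hf) x) y
  rw [Matrix.star_eq_conjTranspose, funMat_mul, Matrix.of_apply, Matrix.conjTranspose_apply,
    hxy] at h
  by_contra hne
  rw [Matrix.one_apply_ne hne] at h
  simp [funMat] at h

theorem funMat_mul_diagonal_mul_conjTranspose {f : (κ → Fin 2) → κ → Fin 2}
    (hf : Function.Injective f) (d : (κ → Fin 2) → ℂ) :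
    funMat f * Matrix.diagonal d * (funMat f).conjTranspose = Matrix.diagonal (d ∘ f) := by
  ext x y
  rw [mul_assoc, funMat_mul, Matrix.of_apply, Matrix.diagonal_mul, Matrix.conjTranspose_apply,
    Matrix.diagonal_apply]
  simp only [funMat, Matrix.of_apply, hf.eq_iff]
  split_ifs <;> simp

theorem circuitUnitary_flatMap_funMat {I : Type*} (l : List I)
    (F : I → List (Finset κ × QOp κ)) (f : I → (κ → Fin 2) → κ → Fin 2)
    (hF : ∀ i ∈ l, circuitUnitary (F i) = funMat (f i)) :
    circuitUnitary (l.flatMap F) = funMat fun x => l.foldl (fun x i => f i x) x := by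
  induction l with
  | nil => exact funMat_id.symm
  | cons i l ih =>
    rw [List.flatMap_cons, circuitUnitary_append, hF i List.mem_cons_self,
      ih fun j hj => hF j (List.mem_cons_of_mem _ hj), funMat_mul_funMat]
    rfl

/-- By the one-hot encoding only the gate of the pair `(s₀, x r)` can fire. Its flip hits a qubit of
`w'`, which controls nothing, so the other gates see unchanged controls. -/
theorem foldl_toffoliFun {w w' : σ → κ} {r : κ} (δ : σ → Fin 2 → σ)
    (hw : ∀ s s', w s ≠ w' s') (hr : ∀ s, r ≠ w' s) (s₀ : σ) {l : List (σ × Fin 2)}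
    (hl : l.Nodup) {x : κ → Fin 2} (hx : ∀ s, x (w s) = if s = s₀ then 1 else 0) :
    l.foldl (fun x p => toffoliFun p.2 (w p.1) r (w' (δ p.1 p.2)) x) x
      = if (s₀, x r) ∈ l then flipFun (w' (δ s₀ (x r))) x else x := by
  induction l generalizing x with
  | nil => simp
  | cons p l ih =>
    obtain ⟨hpl, hl'⟩ := List.nodup_cons.1 hl
    obtain ⟨s, β⟩ := p
    rw [List.foldl_cons]
    by_cases h : s = s₀ ∧ x r = β
    · obtain ⟨rfl, rfl⟩ := h
      have h1 : toffoliFun (x r) (w s) r (w' (δ s (x r))) x = flipFun (w' (δ s (x r))) x :=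
        if_pos ⟨by simp [hx], rfl⟩
      have h2 : flipFun (w' (δ s (x r))) x r = x r := Function.update_of_ne (hr _) _ _
      have h3 : ∀ s', flipFun (w' (δ s (x r))) x (w s') = x (w s') :=
        fun s' => Function.update_of_ne (hw _ _) _ _
      simp only [h1]
      rw [ih hl' fun s' => by rw [h3, hx], h2, if_neg hpl, if_pos List.mem_cons_self]
    · have h1 : toffoliFun β (w s) r (w' (δ s β)) x = x := by
        refine if_neg fun H => h ⟨?_, H.2⟩
        by_contra hne
        rw [hx, if_neg hne] at H
        exact absurd H.1 (by decide)
      simp only [h1]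
      rw [ih hl' hx]
      have : (s₀, x r) ∈ (s, β) :: l ↔ (s₀, x r) ∈ l := by
        rw [List.mem_cons, Prod.mk.injEq]
        refine or_iff_right fun H => h ⟨H.1.symm, H.2⟩
      simp only [this]

/-- One step of a branching program: the state in one-hot encoding on the qubits `w` is updated with
the qubit `r` and written to the fresh qubits `w'`. -/
noncomputable def layerCircuit (w w' : σ → κ) (r : κ) (δ : σ → Fin 2 → σ) :
    List (Finset κ × QOp κ) :=
  (Finset.univ : Finset (σ × Fin 2)).toList.flatMap fun p =>
    toffoliCircuit p.2 (w p.1) r (w' (δ p.1 p.2))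

theorem layerCircuit_length (w w' : σ → κ) (r : κ) (δ : σ → Fin 2 → σ) :
    (layerCircuit w w' r δ).length = 10 * Fintype.card σ := by
  simp [layerCircuit, toffoliCircuit, List.length_flatMap]
  ring

theorem layerCircuit_twoLocal {w w' : σ → κ} {r : κ} (δ : σ → Fin 2 → σ)
    (hw : ∀ s s', w s ≠ w' s') (hr : ∀ s, r ≠ w s) (hr' : ∀ s, r ≠ w' s) :
    ∀ g ∈ layerCircuit w w' r δ, IsTwoLocalGate g.1 g.2 := by
  intro g hg
  obtain ⟨p, -, hp⟩ := List.mem_flatMap.1 hg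
  exact toffoliCircuit_twoLocal _ (hr _).symm (hw _ _) (hr' _) g hp

theorem exists_circuitUnitary_layerCircuit {w w' : σ → κ} {r : κ} (δ : σ → Fin 2 → σ)
    (hw : ∀ s s', w s ≠ w' s') (hr : ∀ s, r ≠ w s) (hr' : ∀ s, r ≠ w' s) :
    ∃ f, circuitUnitary (layerCircuit w w' r δ) = funMat f ∧
      ∀ x s₀, (∀ s, x (w s) = if s = s₀ then 1 else 0) → f x = flipFun (w' (δ s₀ (x r))) x := by
  refine ⟨_, circuitUnitary_flatMap_funMat _ _ _ fun p _ =>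
    circuitUnitary_toffoliCircuit p.2 (hr p.1).symm (hw _ _) (hr' _), fun x s₀ hx => ?_⟩
  rw [foldl_toffoliFun δ hw hr' s₀ (Finset.nodup_toList _) hx]
  simp

/-- Each step writes to a fresh layer of zero qubits, which keeps an arbitrary, possibly
non-injective, transition reversible. The invariant is that layer `t` is one-hot and all later
layers are zero. -/
theorem exists_program_circuit (w : ℕ → σ → κ) (B : ℕ)
    (hw : ∀ t t' s s', t ≤ B → t' ≤ B → w t s = w t' s' → t = t' ∧ s = s')
    (ps : List (κ × (σ → Fin 2 → σ))) (hr : ∀ p ∈ ps, ∀ t s, p.1 ≠ w t s) (t : ℕ)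
    (ht : t + ps.length ≤ B) :
    ∃ L f, (∀ g ∈ L, IsTwoLocalGate g.1 g.2) ∧ L.length = 10 * Fintype.card σ * ps.length ∧
      circuitUnitary L = funMat f ∧
      ∀ (x : κ → Fin 2) s₀, (∀ s, x (w t s) = if s = s₀ then 1 else 0) →
        (∀ t' s, t < t' → t' ≤ B → x (w t' s) = 0) →
        ∀ s, f x (w (t + ps.length) s)
          = if s = ps.foldl (fun s p => p.2 s (x p.1)) s₀ then 1 else 0 := by
  induction ps generalizing t with
  | nil =>
    exact ⟨[], id, by simp, by simp, by rw [funMat_id]; rfl, fun x s₀ hx _ s => hx s⟩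
  | cons p ps ih =>
    rw [List.length_cons] at ht
    obtain ⟨L, f, hL, hlen, hU, hf⟩ := ih (fun q hq => hr q (List.mem_cons_of_mem _ hq)) (t + 1)
      (by omega)
    have hww : ∀ s s', w t s ≠ w (t + 1) s' := fun s s' h => by
      have := (hw _ _ _ _ (by omega) (by omega) h).1
      omega
    have hrp := hr p List.mem_cons_self
    obtain ⟨f₀, hU₀, hf₀⟩ := exists_circuitUnitary_layerCircuit p.2 hww (hrp t) (hrp (t + 1))
    refine ⟨layerCircuit (w t) (w (t + 1)) p.1 p.2 ++ L, f ∘ f₀, ?_, ?_, ?_, ?_⟩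
    · intro g hg
      rcases List.mem_append.1 hg with hg | hg
      exacts [layerCircuit_twoLocal p.2 hww (hrp t) (hrp (t + 1)) g hg, hL g hg]
    · rw [List.length_append, layerCircuit_length, hlen, List.length_cons]
      ring
    · rw [circuitUnitary_append, hU₀, hU, funMat_mul_funMat]
    · intro x s₀ hx hx0 s
      rw [Function.comp_apply, hf₀ x s₀ hx, List.length_cons, List.foldl_cons,
        show t + (ps.length + 1) = t + 1 + ps.length by ring]
      set x₁ := flipFun (w (t + 1) (p.2 s₀ (x p.1))) x with hx₁
      have hoff : ∀ i, i ≠ w (t + 1) (p.2 s₀ (x p.1)) → x₁ i = x i :=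
        fun i hi => Function.update_of_ne hi _ _
      rw [hf x₁ (p.2 s₀ (x p.1))]
      · have hfold : ps.foldl (fun s q => q.2 s (x₁ q.1)) (p.2 s₀ (x p.1))
            = ps.foldl (fun s q => q.2 s (x q.1)) (p.2 s₀ (x p.1)) :=
          List.foldl_ext _ _ _ fun a q hq => by
            rw [hoff _ (hr q (List.mem_cons_of_mem _ hq) _ _)]
        rw [hfold]
      · intro s'
        split_ifs with hs
        · rw [hs, hx₁, flipFun, Function.update_self, hx0 _ _ (by omega) (by omega), zero_add]
        · rw [hoff _ fun h => hs (hw _ _ _ _ (by omega) (by omega) h).2,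
            hx0 _ _ (by omega) (by omega)]
      · intro t' s' h1 h2
        rw [hoff _ fun h => by have := (hw _ _ _ _ (by omega) (by omega) h).1; omega,
          hx0 _ _ (by omega) h2]

theorem exists_branching_circuit (ps : List (κ × (σ → Fin 2 → σ))) (w : ℕ → σ → κ)
    (hw : ∀ t t' s s', t ≤ ps.length → t' ≤ ps.length → w t s = w t' s' → t = t' ∧ s = s')
    (hr : ∀ p ∈ ps, ∀ t s, p.1 ≠ w t s) (s₀ : σ) :
    ∃ L f, (∀ g ∈ L, IsTwoLocalGate g.1 g.2) ∧ L.length = 1 + 10 * Fintype.card σ * ps.length ∧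
      circuitUnitary L = funMat f ∧ Function.Injective f ∧
      ∀ x : κ → Fin 2, (∀ t s, x (w t s) = 0) → ∀ s, f x (w ps.length s)
          = if s = ps.foldl (fun s p => p.2 s (x p.1)) s₀ then 1 else 0 := by
  obtain ⟨L, f, hL, hlen, hU, hf⟩ := exists_program_circuit w ps.length hw ps hr 0 (by simp)
  -- One extra flip prepares the one-hot encoding of the initial state from all-zero ancillas.
  have hL' : ∀ g ∈ ({w 0 s₀}, funMat (flipFun (w 0 s₀))) :: L, IsTwoLocalGate g.1 g.2 := by
    intro g hg
    rcases List.mem_cons.1 hg with rfl | hg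
    exacts [isTwoLocalGate_flipFun _, hL g hg]
  have hU' : circuitUnitary (({w 0 s₀}, funMat (flipFun (w 0 s₀))) :: L)
      = funMat (f ∘ flipFun (w 0 s₀)) := by
    rw [← funMat_mul_funMat, ← hU]
    simp [circuitUnitary]
  refine ⟨_, _, hL', by rw [List.length_cons, hlen, add_comm], hU',
    injective_of_funMat_mem_unitary (hU' ▸ circuitUnitary_mem_unitary hL'), fun x hx s => ?_⟩
  have hoff : ∀ i, i ≠ w 0 s₀ → flipFun (w 0 s₀) x i = x i :=
    fun i hi => Function.update_of_ne hi _ _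
  have key := hf (flipFun (w 0 s₀) x) s₀ ?_ ?_ s
  · rw [zero_add] at key
    rw [Function.comp_apply, key]
    have hfold : ps.foldl (fun s q => q.2 s (flipFun (w 0 s₀) x q.1)) s₀
        = ps.foldl (fun s q => q.2 s (x q.1)) s₀ :=
      List.foldl_ext _ _ _ fun a q hq => by rw [hoff _ (hr q hq _ _)]
    rw [hfold]
  · intro s'
    split_ifs with hs
    · rw [hs, flipFun, Function.update_self, hx, zero_add]
    · rw [hoff _ fun h => hs (hw _ _ _ _ (by omega) (by omega) h).2, hx]
  · intro t' s' h1 h2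
    rw [hoff _ fun h => by have := (hw _ _ _ _ (by omega) (by omega) h).1; omega, hx]

end Branching

/-! ### A branching program that counts failing blocks -/

/-- The states are pairs of a counter and the last failing block. -/
def failStep {m : ℕ} (i : Fin m) (s : ZMod (m + 1) × Option (Fin m)) (b : Fin 2) :
    ZMod (m + 1) × Option (Fin m) :=
  if b = 0 ∨ s.2 = some i then s else (s.1 + 1, some i)

/-- Read the qubits `e i q` for `i < m` and `q ∈ Q`. -/
noncomputable def failProgram {κ κ' : Type*} {m : ℕ} (e : Fin m → κ → κ') (Q : Finset κ) :
    List (κ' × (ZMod (m + 1) × Option (Fin m) → Fin 2 → ZMod (m + 1) × Option (Fin m))) :=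
  (List.finRange m).flatMap fun i => Q.toList.map fun q => (e i q, failStep i)

theorem failProgram_length {κ κ' : Type*} {m : ℕ} (e : Fin m → κ → κ') (Q : Finset κ) :
    (failProgram e Q).length = m * Q.card := by
  simp [failProgram, List.length_flatMap]

theorem foldl_failStep_of_eq {κ : Type*} {m : ℕ} (i : Fin m) (b : κ → Fin 2) (l : List κ)
    {s : ZMod (m + 1) × Option (Fin m)} (hs : s.2 = some i) :
    l.foldl (fun s q => failStep i s (b q)) s = s := by
  induction l with
  | nil => rfl
  | cons q l ih => rw [List.foldl_cons, failStep, if_pos (Or.inr hs), ih]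

-- The first nonzero qubit of a block increments the counter and records the block; from then on the
-- block is inert, so it is counted once.
open Classical in
theorem foldl_failStep {κ : Type*} {m : ℕ} (i : Fin m) (b : κ → Fin 2) (l : List κ)
    {s : ZMod (m + 1) × Option (Fin m)} (hs : s.2 ≠ some i) :
    l.foldl (fun s q => failStep i s (b q)) s
      = if ∀ q ∈ l, b q = 0 then s else (s.1 + 1, some i) := by
  induction l with
  | nil => simp
  | cons q l ih =>
    rw [List.foldl_cons, failStep]
    by_cases hb : b q = 0
    · rw [if_pos (Or.inl hb), ih]
      simp [hb]
    · rw [if_neg (by tauto), foldl_failStep_of_eq i b l rfl, if_neg]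
      exact fun H => hb (H q List.mem_cons_self)

open Classical in
theorem foldl_failProgram_blocks {κ : Type*} {m : ℕ} (b : Fin m → κ → Fin 2) (lq : List κ)
    {l : List (Fin m)} (hl : l.Nodup) {s : ZMod (m + 1) × Option (Fin m)}
    (hs : ∀ i ∈ l, s.2 ≠ some i) :
    (l.foldl (fun s i => lq.foldl (fun s q => failStep i s (b i q)) s) s).1
      = s.1 + ((l.filter fun i => ¬ ∀ q ∈ lq, b i q = 0).length : ZMod (m + 1)) := by
  induction l generalizing s with
  | nil => simp
  | cons i l ih =>
    obtain ⟨hil, hl⟩ := List.nodup_cons.1 hl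
    rw [List.foldl_cons, foldl_failStep i (b i) lq (hs i List.mem_cons_self)]
    split_ifs with h
    · rw [ih hl fun j hj => hs j (List.mem_cons_of_mem _ hj), List.filter_cons_of_neg (by simpa using h)]
    · rw [ih hl, List.filter_cons_of_pos (by simpa using h), List.length_cons]
      · push_cast; ring
      · rintro j hj h'
        exact hil (Option.some.inj h' ▸ hj)

open Classical in
theorem foldl_failProgram {κ κ' : Type*} {m : ℕ} (e : Fin m → κ → κ') (Q : Finset κ)
    (x : κ' → Fin 2) :
    (List.foldl (fun (s : ZMod (m + 1) × Option (Fin m)) (p : κ' × (ZMod (m + 1) × Option (Fin m) →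
      Fin 2 → ZMod (m + 1) × Option (Fin m))) => p.2 s (x p.1)) (0, none) (failProgram e Q)).1.val
      = (Finset.univ.filter fun i => ¬ ∀ q ∈ Q, x (e i q) = 0).card := by
  rw [failProgram, List.foldl_flatMap]
  simp only [List.foldl_map]
  rw [foldl_failProgram_blocks (fun i q => x (e i q)) Q.toList (List.nodup_finRange m) (by simp),
    zero_add]
  have hcard : ((List.finRange m).filter fun i => ¬ ∀ q ∈ Q.toList, x (e i q) = 0).length
      = (Finset.univ.filter fun i => ¬ ∀ q ∈ Q, x (e i q) = 0).card := by
    simp only [Finset.mem_toList]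
    rw [← List.toFinset_card_of_nodup ((List.nodup_finRange m).filter _)]
    congr 1
    ext i
    simp
  -- At most `m` blocks fail, so the counter modulo `m + 1` never wraps around.
  rw [hcard, ZMod.val_natCast_of_lt]
  exact Nat.lt_succ_of_le ((Finset.card_le_univ _).trans (by simp))

/-! ### Outcome distributions of circuits -/

section Outcome

set_option linter.unusedSectionVars false

variable {α ι : Type*} [Fintype α] [DecidableEq α] [Fintype ι] [DecidableEq ι]

/-- The probability of the outcome `z` when the state `ρ` with ancillas in the all-zero state is
measured in the basis given by the columns of `U`. -/
noncomputable def outcomeWeight (U : QOp (α ⊕ ι)) (ρ : QOp ι) (z : α ⊕ ι → Fin 2) : ℂ :=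
  ∑ x, ∑ y, U (Sum.elim 0 x) z * star (U (Sum.elim 0 y) z) * ρ y x

theorem outcomeWeight_nonneg (U : QOp (α ⊕ ι)) {ρ : QOp ι} (hρ : ρ.PosSemidef)
    (z : α ⊕ ι → Fin 2) : 0 ≤ outcomeWeight U ρ z := by
  refine (hρ.dotProduct_mulVec_nonneg fun x => U (Sum.elim 0 x) z).trans_eq ?_
  simp only [dotProduct, Matrix.mulVec, Pi.star_apply, outcomeWeight, Finset.mul_sum]
  rw [Finset.sum_comm]
  exact Finset.sum_congr rfl fun x _ => Finset.sum_congr rfl fun y _ => by ring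

theorem sum_outcomeWeight {U : QOp (α ⊕ ι)}
    (hU : U ∈ Matrix.unitaryGroup (α ⊕ ι → Fin 2) ℂ) (ρ : QOp ι) :
    ∑ z, outcomeWeight U ρ z = ρ.trace := by
  have h1 : ∀ x y : ι → Fin 2, ∑ z, U (Sum.elim 0 x) z * star (U (Sum.elim 0 y) z)
      = if x = y then 1 else 0 := by
    intro x y
    have h := congrFun (congrFun (Matrix.mem_unitaryGroup_iff.1 hU)
      (Sum.elim (0 : α → Fin 2) x)) (Sum.elim (0 : α → Fin 2) y)
    rw [Matrix.mul_apply, Matrix.one_apply] at h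
    simp only [Matrix.star_apply] at h
    rw [h]
    congr 1
    rw [eq_iff_iff]
    refine ⟨fun H => funext fun i => congrFun H (Sum.inr i), fun H => by rw [H]⟩
  simp only [outcomeWeight]
  rw [Finset.sum_comm, Matrix.trace]
  refine Finset.sum_congr rfl fun x _ => ?_
  rw [Finset.sum_comm]
  simp only [← Finset.sum_mul, h1]
  simp

theorem trace_mul_eq_sum_outcomeWeight {U : QOp (α ⊕ ι)} {Λ : QOp ι}
    (d : (α ⊕ ι → Fin 2) → ℂ)
    (hΛ : ∀ x y, Λ x y = ∑ z, d z * (U (Sum.elim 0 x) z * star (U (Sum.elim 0 y) z)))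
    (ρ : QOp ι) : (Λ * ρ).trace = ∑ z, d z * outcomeWeight U ρ z := by
  simp only [Matrix.trace, Matrix.diag_apply, Matrix.mul_apply, hΛ, outcomeWeight,
    Finset.mul_sum, Finset.sum_mul]
  rw [Finset.sum_comm' (t' := Finset.univ) (s' := fun _ => Finset.univ) (by simp)]
  conv_rhs => rw [Finset.sum_comm]
  rw [Finset.sum_comm]
  refine Finset.sum_congr rfl fun x _ => ?_
  conv_rhs => rw [Finset.sum_comm]
  exact Finset.sum_congr rfl fun y _ => Finset.sum_congr rfl fun z _ => by ring

/-- Measuring all copies in the basis of `U` gives independent outcomes: the joint weight is the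
product of the single-copy weights. -/
theorem trace_mul_tensorPower_eq_sum {U : QOp (α ⊕ ι)} {m : ℕ} {Λ : QOp (Fin m × ι)}
    (D : (Fin m → α ⊕ ι → Fin 2) → ℂ)
    (hΛ : ∀ x y, Λ x y = ∑ z, D z * ∏ i, (U (Sum.elim 0 fun j => x (i, j)) (z i) *
      star (U (Sum.elim 0 fun j => y (i, j)) (z i))))
    (ρ : QOp ι) : (Λ * tensorPower ρ m).trace = ∑ z, D z * ∏ i, outcomeWeight U ρ (z i) := by
  let c : (Fin m × ι → Fin 2) ≃ (Fin m → ι → Fin 2) := Equiv.curry _ _ _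
  have h1 : ∀ z : Fin m → α ⊕ ι → Fin 2, ∏ i, outcomeWeight U ρ (z i)
      = ∑ x : Fin m × ι → Fin 2, ∑ y : Fin m × ι → Fin 2,
        ∏ i, (U (Sum.elim 0 fun j => x (i, j)) (z i) *
          star (U (Sum.elim 0 fun j => y (i, j)) (z i)) *
          ρ (fun j => y (i, j)) (fun j => x (i, j))) := by
    intro z
    simp only [outcomeWeight]
    rw [Finset.prod_univ_sum, Fintype.piFinset_univ]
    refine (Fintype.sum_equiv c _ _ fun x => ?_).symm
    rw [Finset.prod_univ_sum, Fintype.piFinset_univ]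
    exact Fintype.sum_equiv c _ _ fun y => rfl
  simp only [h1, Matrix.trace, Matrix.diag_apply, Matrix.mul_apply, hΛ,
    Finset.mul_sum, Finset.sum_mul]
  conv_rhs => rw [Finset.sum_comm]
  refine Finset.sum_congr rfl fun x _ => ?_
  conv_rhs => rw [Finset.sum_comm]
  refine Finset.sum_congr rfl fun y _ => Finset.sum_congr rfl fun z _ => ?_
  rw [Finset.prod_mul_distrib (f := fun i => _ * _), tensorPower, Matrix.of_apply]
  ring

end Outcome

/-! ### Counting the copies on which a test fails -/

/-- Only touched qubits are measured and a gate touches at most two. This keeps the length of the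
counting program polynomial, however large the register is. -/
theorem card_filter_eq_proj0_le {κ : Type*} [Fintype κ] [DecidableEq κ]
    {L : List (Finset κ × QOp κ)} (hL : ∀ g ∈ L, IsTwoLocalGate g.1 g.2) {Q : Finset κ}
    (hQ : ∀ i, (∀ g ∈ L, i ∉ g.1) → i ∉ Q) : Q.card ≤ 2 * L.length := by
  have h1 : Q ⊆ L.toFinset.biUnion Prod.fst := by
    intro i hi
    by_contra hne
    refine hQ i (fun g hg hig => hne ?_) hi
    exact Finset.mem_biUnion.2 ⟨g, by simpa using hg, hig⟩
  refine (Finset.card_le_card h1).trans (Finset.card_biUnion_le.trans ?_)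
  refine (Finset.sum_le_card_nsmul _ _ 2 fun g hg => (hL g (by simpa using hg)).1).trans ?_
  rw [smul_eq_mul, mul_comm]
  exact Nat.mul_le_mul_left _ (List.toFinset_card_le _)

theorem mul_diagonal_mul_conjTranspose_apply {n : Type*} [Fintype n] [DecidableEq n]
    (W : Matrix n n ℂ) (d : n → ℂ) (x y : n) :
    (W * Matrix.diagonal d * W.conjTranspose) x y = ∑ z, d z * (W x z * star (W y z)) := by
  rw [Matrix.mul_apply]
  simp only [Matrix.mul_diagonal, Matrix.conjTranspose_apply]
  exact Finset.sum_congr rfl fun z _ => by ring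

/-! ### Register layout and the counting effect -/

/-- States of the failure counter. -/
abbrev CounterState (m : ℕ) := ZMod (m + 1) × Option (Fin m)

/-- `m` copies of a register `α ⊕ ι`, with further ancillas for `T + 1` counter states. -/
abbrev CopyRegister (m T : ℕ) (α ι : Type*) :=
  ((Fin m × α) ⊕ (Fin (T + 1) × CounterState m)) ⊕ (Fin m × ι)

/-- The qubit `k` of the `i`-th copy of the register `α ⊕ ι`. -/
def copyQubit (m T : ℕ) (α ι : Type*) (i : Fin m) : α ⊕ ι → CopyRegister m T α ι :=
  Sum.elim (fun j => Sum.inl (Sum.inl (i, j))) fun j => Sum.inr (i, j)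

theorem copyQubit_inj {m T : ℕ} {α ι : Type*} {i j : Fin m} {k k' : α ⊕ ι}
    (h : copyQubit m T α ι i k = copyQubit m T α ι j k') : i = j ∧ k = k' := by
  rcases k with a | a <;> rcases k' with b | b <;> simp_all [copyQubit]

/-- The `i`-th copy of the register `α ⊕ ι`. -/
def copyEmbedding (m T : ℕ) (α ι : Type*) (i : Fin m) : (α ⊕ ι) ↪ CopyRegister m T α ι :=
  ⟨copyQubit m T α ι i, fun _ _ h => (copyQubit_inj h).2⟩

/-- The qubit encoding the counter state `s` after `t` steps. -/
def counterQubit (m T : ℕ) (α ι : Type*) (t : ℕ) (s : CounterState m) : CopyRegister m T α ι :=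
  Sum.inl (Sum.inr (Fin.ofNat (T + 1) t, s))

theorem copyQubit_ne_counterQubit {m T : ℕ} {α ι : Type*} (i : Fin m) (k : α ⊕ ι) (t : ℕ)
    (s : CounterState m) : copyQubit m T α ι i k ≠ counterQubit m T α ι t s := by
  rcases k with a | a <;> simp [copyQubit, counterQubit]

theorem counterQubit_inj {m T : ℕ} {α ι : Type*} {t t' : ℕ} {s s' : CounterState m} (ht : t ≤ T)
    (ht' : t' ≤ T) (h : counterQubit m T α ι t s = counterQubit m T α ι t' s') :
    t = t' ∧ s = s' := by
  simp only [counterQubit, Sum.inl.injEq, Sum.inr.injEq, Prod.mk.injEq] at h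
  refine ⟨?_, h.2⟩
  have := congrArg Fin.val h.1
  simp only [Fin.ofNat] at this
  rwa [Nat.mod_eq_of_lt (by omega), Nat.mod_eq_of_lt (by omega)] at this

-- The test circuit runs on every copy, then the counter reads the measured qubits. The three
-- summands of the cost are the test circuits, the branching program, and the identity gates on the
-- measured counter qubits.
open Classical in
theorem exists_counting_effect {α ι : Type*} [Fintype α] [DecidableEq α] [Fintype ι]
    [DecidableEq ι] {L : List (Finset (α ⊕ ι) × QOp (α ⊕ ι))}
    (hL : ∀ g ∈ L, IsTwoLocalGate g.1 g.2) (Q : Finset (α ⊕ ι)) (m : ℕ) (acc : ℕ → Prop) {G : ℕ}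
    (hG : m * L.length + (1 + 10 * ((m + 1) * (m + 1)) * (m * Q.card)) + (m + 1) * (m + 1) ≤ G) :
    ∃ Λ ∈ effects (Fin m × ι) G, ∀ x y, Λ x y = ∑ z : Fin m → α ⊕ ι → Fin 2,
      (if acc (Finset.univ.filter fun i => ¬ ∀ q ∈ Q, z i q = 0).card then 1 else 0) *
        ∏ i, (circuitUnitary L (Sum.elim 0 fun j => x (i, j)) (z i) *
          star (circuitUnitary L (Sum.elim 0 fun j => y (i, j)) (z i))) := by
  let T := m * Q.card
  let e := copyEmbedding m (m * Q.card) α ι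
  let w := counterQubit m (m * Q.card) α ι
  have he : ∀ i j k k', e i k = e j k' → i = j := fun i j k k' h => (copyQubit_inj h).1
  have hew : ∀ i k t s, e i k ≠ w t s := copyQubit_ne_counterQubit
  let ps := failProgram (fun i => e i) Q
  have hlen : ps.length = T := failProgram_length _ _
  obtain ⟨Lp, f, hLp, hLplen, hUp, hfinj, hf⟩ := exists_branching_circuit ps w
    (fun t t' s s' ht ht' => counterQubit_inj (by omega) (by omega))
    (by
      intro p hp t s
      obtain ⟨i, -, hp⟩ := List.mem_flatMap.1 hp
      obtain ⟨q, -, rfl⟩ := List.mem_map.1 hp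
      exact hew _ _ _ _)
    (0, none)
  let L₁ : List (Finset (CopyRegister m (m * Q.card) α ι) × QOp (CopyRegister m (m * Q.card) α ι)) := (List.finRange m).flatMap fun i => liftCircuit (e i) L
  have hL₁ : ∀ g ∈ L₁, IsTwoLocalGate g.1 g.2 := by
    intro g hg
    obtain ⟨i, -, hg⟩ := List.mem_flatMap.1 hg
    exact liftCircuit_twoLocal (e i) hL g hg
  -- Exactly one final counter qubit is `1`. Requiring `0` on all rejecting states therefore selects
  -- precisely the accepted counts, whatever the predicate `acc`.
  let R : Finset (CopyRegister m (m * Q.card) α ι) := (Finset.univ.filter fun s : CounterState m => ¬ acc s.1.val).image (w T)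
  have hR : R.card ≤ (m + 1) * (m + 1) := by
    refine Finset.card_image_le.trans ((Finset.card_le_univ _).trans ?_)
    simp [ZMod.card]
  let A : CopyRegister m (m * Q.card) α ι → Matrix (Fin 2) (Fin 2) ℂ := fun i => if i ∈ R then proj0 else 1
  let W := circuitUnitary (L₁ ++ Lp)
  have hA : ∀ i, A i = proj0 ∨ A i = 1 := fun i => by
    simp only [A]; split_ifs <;> simp
  let d : (CopyRegister m (m * Q.card) α ι → Fin 2) → ℂ := fun z => if ∀ i, A i = proj0 → z i = 0 then 1 else 0
  -- The counter permutes basis labels, so conjugation by it only relabels the diagonal observable;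
  -- what remains is classical postprocessing of the test outcomes.
  have hW : W * tensorOp A * W.conjTranspose = circuitUnitary L₁ * Matrix.diagonal (d ∘ f) *
      (circuitUnitary L₁).conjTranspose := by
    rw [tensorOp_eq_diagonal hA, ← funMat_mul_diagonal_mul_conjTranspose hfinj, ← hUp]
    simp only [W, circuitUnitary_append, Matrix.conjTranspose_mul, mul_assoc]
    rfl
  refine ⟨Matrix.of fun x y => (W * tensorOp A * W.conjTranspose) (Sum.elim 0 x) (Sum.elim 0 y),
    mem_effects_of_circuit (L := L₁ ++ Lp) ?_ R ?_ fun x y => rfl, fun x y => ?_⟩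
  · intro g hg
    rcases List.mem_append.1 hg with hg | hg
    exacts [hL₁ g hg, hLp g hg]
  · refine le_trans ?_ hG
    have h1 : L₁.length = m * L.length := by simp [L₁, List.length_flatMap, liftCircuit]
    have h2 : Fintype.card (CounterState m) = (m + 1) * (m + 1) := by simp [ZMod.card]
    rw [List.length_append, h1, hLplen, hlen, h2]
    exact Nat.add_le_add_left hR _
  let E : (Fin m × (α ⊕ ι)) ↪ CopyRegister m (m * Q.card) α ι := ⟨fun p => e p.1 p.2, by
    rintro ⟨i, k⟩ ⟨j, k'⟩ h
    obtain rfl := he _ _ _ _ h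
    exact Prod.ext rfl ((e i).injective h)⟩
  have hE : ∀ c, (∀ i ∈ List.finRange m, c ∉ Set.range (e i)) ↔ c ∉ Set.range E := by
    intro c
    constructor
    · rintro h ⟨⟨i, k⟩, hk⟩
      exact h i (List.mem_finRange i) ⟨k, hk⟩
    · rintro h i - ⟨k, hk⟩
      exact h ⟨(i, k), hk⟩
  have hoffE : ∀ c, c ∉ Set.range E → ∃ p, c = Sum.inl (Sum.inr p) := by
    rintro ((⟨i, a⟩ | p) | ⟨i, a⟩) h
    · exact absurd ⟨(i, Sum.inl a), rfl⟩ h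
    · exact ⟨p, rfl⟩
    · exact absurd ⟨(i, Sum.inr a), rfl⟩ h
  have hU₁ : ∀ x z, circuitUnitary L₁ x z = if ∀ c, c ∉ Set.range E → x c = z c then
      ∏ i, circuitUnitary L (x ∘ e i) (z ∘ e i) else 0 := by
    intro x z
    simp only [L₁]
    rw [circuitUnitary_flatMap]
    simp only [circuitUnitary_liftCircuit]
    rw [prod_liftOp_apply e he _ (List.nodup_finRange m)]
    simp only [hE]
    rw [← List.ofFn_eq_map, List.prod_ofFn]
  have hcomp : ∀ (x : Fin m × ι → Fin 2) i, (Sum.elim 0 x : CopyRegister m (m * Q.card) α ι → Fin 2) ∘ e i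
      = (Sum.elim 0 fun j => x (i, j) : α ⊕ ι → Fin 2) := by
    intro x i
    ext k
    rcases k with k | k <;> rfl
  have hagree : ∀ (x : Fin m × ι → Fin 2) (z : CopyRegister m (m * Q.card) α ι → Fin 2),
      (∀ c, c ∉ Set.range E → (Sum.elim 0 x : CopyRegister m (m * Q.card) α ι → Fin 2) c = z c) ↔
      ∀ c, c ∉ Set.range E → (Sum.elim 0 (0 : Fin m × ι → Fin 2) : CopyRegister m (m * Q.card) α ι → Fin 2) c = z c := by
    intro x z
    refine forall₂_congr fun c hc => ?_
    obtain ⟨p, rfl⟩ := hoffE c hc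
    rfl
  rw [Matrix.of_apply, hW, mul_diagonal_mul_conjTranspose_apply]
  have hterm : ∀ z : CopyRegister m (m * Q.card) α ι → Fin 2, (d ∘ f) z * (circuitUnitary L₁ (Sum.elim 0 x) z *
      star (circuitUnitary L₁ (Sum.elim 0 y) z)) =
      if ∀ c, c ∉ Set.range E → (Sum.elim 0 (0 : Fin m × ι → Fin 2) : CopyRegister m (m * Q.card) α ι → Fin 2) c = z c then
        (d ∘ f) z * ∏ i, (circuitUnitary L (Sum.elim 0 fun j => x (i, j)) (z ∘ e i) *
          star (circuitUnitary L (Sum.elim 0 fun j => y (i, j)) (z ∘ e i))) else 0 := by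
    intro z
    rw [hU₁, hU₁]
    simp only [hcomp, hagree]
    split_ifs
    · rw [Finset.prod_mul_distrib, star_prod]
    · simp
  -- The test circuits leave the counter ancillas at zero, so the sum reduces to labels of the
  -- copies alone.
  refine (Finset.sum_congr rfl fun z _ => (hterm z).trans (by congr)).trans
    ((sum_ite_agree_off_range E (Sum.elim 0 (0 : Fin m × ι → Fin 2)) fun z =>
      (d ∘ f) z * ∏ i, (circuitUnitary L (Sum.elim 0 fun j => x (i, j)) (z ∘ e i) *
        star (circuitUnitary L (Sum.elim 0 fun j => y (i, j)) (z ∘ e i)))).trans ?_)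
  refine Fintype.sum_equiv (Equiv.curry _ _ _) _ _ fun v => ?_
  set z := Function.extend E v (Sum.elim 0 (0 : Fin m × ι → Fin 2) : CopyRegister m (m * Q.card) α ι → Fin 2) with hz
  have hze : ∀ i k, z (e i k) = v (i, k) := fun i k => E.injective.extend_apply _ _ (i, k)
  have hzw : ∀ t s, z (w t s) = 0 := by
    intro t s
    rw [hz, Function.extend_apply']
    · rfl
    · rintro ⟨⟨i, k⟩, h⟩
      exact hew i k t s h
  have hd : (d ∘ f) z = if acc (Finset.univ.filter fun i => ¬ ∀ q ∈ Q, v (i, q) = 0).card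
      then 1 else 0 := by
    simp only [d, Function.comp_apply]
    congr 1
    have hAR : ∀ c, A c = proj0 ↔ c ∈ R := by
      intro c
      simp only [A]
      split_ifs with h
      · simp [h]
      · simp [h, proj0_ne_one.symm]
    have hfw := hf z hzw
    rw [hlen] at hfw
    have hcount := foldl_failProgram (fun i => e i) Q z
    simp only [hze] at hcount
    rw [← hcount]
    simp only [hAR, R, Finset.mem_image, Finset.mem_filter, Finset.mem_univ, true_and, eq_iff_iff,
      forall_exists_index, and_imp]
    constructor
    · intro H
      by_contra hacc
      have := H _ _ hacc rfl
      rw [hfw, if_pos rfl] at this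
      exact absurd this (by decide)
    · rintro H _ s hs rfl
      rw [hfw, if_neg]
      rintro rfl
      exact hs H
  rw [hd]
  congr 1
  refine Finset.prod_congr rfl fun i _ => ?_
  have : z ∘ e i = fun k => v (i, k) := funext fun k => hze i k
  rw [this]
  rfl

/-! ### Threshold tests on independent copies -/

-- The success event `S` and the collective effect are fixed before the state, so one test governs
-- both hypotheses; only the outcome law `μ` varies.
open Classical in
theorem exists_iid_effect {ι : Type*} [Fintype ι] [DecidableEq ι] {Λ : QOp ι} {G : ℕ}
    (hΛ : Λ ∈ effects ι G) (m : ℕ) (acc : ℕ → Prop) {G' : ℕ}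
    (hG : m * G + (1 + 10 * ((m + 1) * (m + 1)) * (m * (2 * G))) + (m + 1) * (m + 1) ≤ G') :
    ∃ (a : ℕ) (S : (Fin a ⊕ ι → Fin 2) → Prop), ∃ Λ' ∈ effects (Fin m × ι) G',
      ∀ ρ, IsQState ρ → ∃ μ : (Fin a ⊕ ι → Fin 2) → ℝ, (∀ z, 0 ≤ μ z) ∧ ∑ z, μ z = 1 ∧
        (Λ * ρ).trace.re = ∑ z, (if S z then μ z else 0) ∧
        (Λ' * tensorPower ρ m).trace.re = ∑ z : Fin m → Fin a ⊕ ι → Fin 2,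
          if acc (Finset.univ.filter fun i => ¬ S (z i)).card then ∏ i, μ (z i) else 0 := by
  obtain ⟨a, L, A, hL, hlen, hA, hA1, hΛ⟩ := hΛ
  let Q : Finset (Fin a ⊕ ι) := Finset.univ.filter fun i => A i = proj0
  have hQ : Q.card ≤ 2 * L.length := card_filter_eq_proj0_le hL fun i hi hiQ => by
    rw [Finset.mem_filter, hA1 i hi] at hiQ
    exact proj0_ne_one hiQ.2.symm
  have hG' : m * L.length + (1 + 10 * ((m + 1) * (m + 1)) * (m * Q.card)) + (m + 1) * (m + 1)
      ≤ G' := by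
    refine le_trans ?_ hG
    gcongr
    exact hQ.trans (by gcongr)
  obtain ⟨Λ', hmem, hΛ'⟩ := exists_counting_effect hL Q m acc hG'
  refine ⟨a, fun z => ∀ q ∈ Q, z q = 0, Λ', hmem, fun ρ hρ => ?_⟩
  let μ := outcomeWeight (circuitUnitary L) ρ
  have hμ : ∀ z, μ z = ((μ z).re : ℂ) := fun z =>
    Complex.ext rfl (Complex.nonneg_iff.1 (outcomeWeight_nonneg _ hρ.1 z)).2.symm
  refine ⟨fun z => (μ z).re, fun z =>
    (Complex.nonneg_iff.1 (outcomeWeight_nonneg _ hρ.1 z)).1, ?_, ?_, ?_⟩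
  · have h := sum_outcomeWeight (circuitUnitary_mem_unitary hL) ρ
    rw [hρ.2] at h
    rw [← Complex.re_sum, h, Complex.one_re]
  · rw [trace_mul_eq_sum_outcomeWeight (U := circuitUnitary L)
      (fun z => if ∀ q ∈ Q, z q = 0 then 1 else 0) _ ρ, Complex.re_sum]
    · refine Finset.sum_congr rfl fun z _ => ?_
      split_ifs <;> simp [μ]
    · intro x y
      rw [hΛ, tensorOp_eq_diagonal hA, mul_diagonal_mul_conjTranspose_apply]
      simp only [Q, Finset.mem_filter, Finset.mem_univ, true_and]
  · rw [trace_mul_tensorPower_eq_sum _ hΛ', Complex.re_sum]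
    refine Finset.sum_congr rfl fun z _ => ?_
    have hprod : ∏ i, outcomeWeight (circuitUnitary L) ρ (z i)
        = ((∏ i, (μ (z i)).re : ℝ) : ℂ) := by
      push_cast
      exact Finset.prod_congr rfl fun i _ => hμ (z i)
    rw [hprod]
    split_ifs with h1 h2 h2
    · rw [one_mul, Complex.ofReal_re]
    · exact absurd (by convert h1) h2
    · exact absurd (by convert h2) h1
    · rw [zero_mul, Complex.zero_re]

theorem effect_trace_mem_Icc {ι : Type*} [Fintype ι] [DecidableEq ι] {Λ : QOp ι} {G : ℕ}
    (hΛ : Λ ∈ effects ι G) {ρ : QOp ι} (hρ : IsQState ρ) : (Λ * ρ).trace.re ∈ Set.Icc 0 1 := by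
  classical
  -- Only the single-copy outcome law is needed here, so zero copies suffice.
  obtain ⟨a, S, Λ', -, h⟩ := exists_iid_effect hΛ 0 (fun _ => True) le_rfl
  obtain ⟨μ, hμ0, hμ1, hp, -⟩ := h ρ hρ
  rw [hp, ← hμ1]
  refine ⟨Finset.sum_nonneg fun z _ => ?_, Finset.sum_le_sum fun z _ => ?_⟩ <;> split_ifs
  exacts [hμ0 z, le_rfl, le_rfl, hμ0 z]

/-- The success frequency is compared with `p - η/2`, just below its mean under `ρ`. This leaves a
small gap for type I errors and almost all of `p - q` for type II errors. -/
theorem exists_threshold_effect {ι : Type*} [Fintype ι] [DecidableEq ι] {Λ : QOp ι} {G : ℕ}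
    (hΛ : Λ ∈ effects ι G) {ρ σ : QOp ι} (hρ : IsQState ρ) (hσ : IsQState σ) {η : ℝ} (hη : 0 < η)
    (hlt : η < (Λ * ρ).trace.re - (Λ * σ).trace.re) (m : ℕ) {G' : ℕ}
    (hG : m * G + (1 + 10 * ((m + 1) * (m + 1)) * (m * (2 * G))) + (m + 1) * (m + 1) ≤ G') :
    ∃ Λ' ∈ effects (Fin m × ι) G',
      1 - (1 - (η / 4) ^ 2) ^ m ≤ (Λ' * tensorPower ρ m).trace.re ∧
      (Λ' * tensorPower σ m).trace.re
        ≤ (1 - ((Λ * ρ).trace.re - (Λ * σ).trace.re - η) ^ 2) ^ m := by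
  classical
  obtain ⟨hp0, hp1⟩ := effect_trace_mem_Icc hΛ hρ
  obtain ⟨hq0, hq1⟩ := effect_trace_mem_Icc hΛ hσ
  set p := (Λ * ρ).trace.re
  set q := (Λ * σ).trace.re
  obtain ⟨a, S, Λ', hmem, h⟩ := exists_iid_effect hΛ m
    (fun c => (c : ℝ) ≤ m * (1 - (p - η / 2))) hG
  have hcard : ∀ z : Fin m → Fin a ⊕ ι → Fin 2,
      ((Finset.univ.filter fun i => S (z i)).card : ℝ)
        + (Finset.univ.filter fun i => ¬ S (z i)).card = m := by
    intro z
    have := Finset.card_filter_add_card_filter_not (s := Finset.univ) fun i => S (z i)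
    rw [Finset.card_univ, Fintype.card_fin] at this
    exact_mod_cast this
  refine ⟨Λ', hmem, ?_, ?_⟩
  · obtain ⟨μ, hμ0, hμ1, hS, hT⟩ := h ρ hρ
    -- The slack `η/4` keeps the Chernoff parameter positive even if `p = 1`; the gap to `1 - p +
    -- η/2` is still `η/4`.
    have hq : ∑ z, (if ¬ S z then μ z else 0) ≤ 1 - p + η / 4 := by
      have : ∑ z, (if S z then μ z else 0) + ∑ z, (if ¬ S z then μ z else 0) = 1 := by
        rw [← Finset.sum_add_distrib, ← hμ1]
        refine Finset.sum_congr rfl fun z _ => ?_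
        by_cases hz : S z <;> simp [hz]
      linarith
    have key := chernoff_bound μ hμ0 hμ1 (fun z => ¬ S z) hq (p := 1 - p + η / 2) (by linarith)
      (by linarith) (by linarith) m
    have htot : ∑ z : Fin m → Fin a ⊕ ι → Fin 2, ∏ i, μ (z i) = 1 := by
      rw [← Fintype.sum_pow, hμ1, one_pow]
    have hle : 1 ≤ (Λ' * tensorPower ρ m).trace.re
        + ∑ z : Fin m → Fin a ⊕ ι → Fin 2, (if (m : ℝ) * (1 - p + η / 2) ≤
          (Finset.univ.filter fun i => ¬ S (z i)).card then ∏ i, μ (z i) else 0) := by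
      refine htot.symm.le.trans ?_
      rw [hT, ← Finset.sum_add_distrib]
      refine Finset.sum_le_sum fun z _ => ?_
      have hnn : 0 ≤ ∏ i, μ (z i) := Finset.prod_nonneg fun i _ => hμ0 _
      rw [show 1 - (p - η / 2) = 1 - p + η / 2 by ring]
      split_ifs with h1 h2 h2
      · linarith
      · linarith
      · linarith
      · exact absurd (not_le.1 h1).le h2
    have hring : 1 - p + η / 2 - (1 - p + η / 4) = η / 4 := by ring
    rw [hring] at key
    linarith
  · obtain ⟨μ, hμ0, hμ1, hS, hT⟩ := h σ hσ
    -- Raising `q` by `η/2` covers `q = 0`; with the lowered threshold the total loss is `η`.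
    have key := chernoff_bound μ hμ0 hμ1 S (q := q + η / 2) (p := p - η / 2) (by linarith)
      (by linarith) (by linarith) (by linarith) m
    rw [show p - η / 2 - (q + η / 2) = p - q - η by ring] at key
    refine le_trans (le_of_eq ?_) key
    rw [hT]
    refine Finset.sum_congr rfl fun z _ => ?_
    have hiff : ((Finset.univ.filter fun i => ¬ S (z i)).card : ℝ) ≤ m * (1 - (p - η / 2)) ↔
        (m : ℝ) * (p - η / 2) ≤ (Finset.univ.filter fun i => S (z i)).card := by
      have := hcard z
      constructor <;> intro h <;> nlinarith
    rw [if_congr hiff rfl rfl]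

/-! ### From threshold tests to the relative entropy -/

theorem le_gateHypRelEntropy {ι : Type*} [Fintype ι] [DecidableEq ι] {Λ ρ σ : QOp ι} {G : ℕ}
    (hΛ : Λ ∈ effects ι G) {ε b : ℝ} (hρ : 1 - ε ≤ (Λ * ρ).trace.re)
    (hσ : (Λ * σ).trace.re ≤ Real.exp (-b)) :
    ENNReal.ofReal b ≤ gateHypRelEntropy ε ρ σ G := by
  have h1 : gateTypeII ε ρ σ G ≤ ENNReal.ofReal (Real.exp (-b)) :=
    (iInf₂_le Λ ⟨hΛ, hρ⟩).trans (ENNReal.ofReal_le_ofReal hσ)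
  have h2 : ENNReal.log (gateTypeII ε ρ σ G) ≤ ((-b : ℝ) : EReal) := by
    refine (ENNReal.log_monotone h1).trans (le_of_eq ?_)
    rw [ENNReal.log_ofReal_of_pos (Real.exp_pos _), Real.log_exp]
  have h3 : (b : EReal) ≤ -ENNReal.log (gateTypeII ε ρ σ G) := by
    rw [EReal.le_neg]
    simpa using h2
  rw [gateHypRelEntropy, ← EReal.real_coe_toENNReal]
  exact EReal.toENNReal_le_toENNReal h3

/-- With `m = n^k ≥ n^{l₀}` the cost is at most `80m⁴ + 5m² + 1 ≤ 86m⁴`, and `m ≥ n ≥ 86` absorbs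
the constant into `m⁵`. -/
theorem counting_cost_le {n k l l₀ : ℕ} (hn : 86 ≤ n) (hk : l₀ ≤ k) (hk1 : 1 ≤ k) (hl : 5 ≤ l) :
    n ^ k * n ^ l₀ + (1 + 10 * ((n ^ k + 1) * (n ^ k + 1)) * (n ^ k * (2 * n ^ l₀)))
      + (n ^ k + 1) * (n ^ k + 1) ≤ n ^ (k * l) := by
  have h1 : n ^ l₀ ≤ n ^ k := Nat.pow_le_pow_right (by omega) hk
  have h2 : n ≤ n ^ k := Nat.le_self_pow (by omega) n
  have h3 : n ^ (k * 5) ≤ n ^ (k * l) := Nat.pow_le_pow_right (by omega) (by gcongr)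
  refine le_trans ?_ h3
  rw [pow_mul]
  generalize n ^ l₀ = g at *
  generalize n ^ k = m at *
  have hm : 1 ≤ m := by omega
  calc m * g + (1 + 10 * ((m + 1) * (m + 1)) * (m * (2 * g))) + (m + 1) * (m + 1)
      ≤ m * m + (1 + 10 * ((m + m) * (m + m)) * (m * (2 * m))) + (m + m) * (m + m) := by gcongr
    _ = 80 * m ^ 4 + 5 * (m ^ 2 * 1 ^ 2) + 1 ^ 4 := by ring
    _ ≤ 80 * m ^ 4 + 5 * (m ^ 2 * m ^ 2) + m ^ 4 := by gcongr
    _ = 86 * m ^ 4 := by ring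
    _ ≤ m * m ^ 4 := by gcongr; omega
    _ = m ^ 5 := by ring

/-- The logarithmic form `-log (1 - s²)` of an advantage `s = max (t - η) 0`. -/
noncomputable def advantageExponent (t η : ℝ) : ℝ := -Real.log (1 - max (t - η) 0 ^ 2)

/-- The threshold for `n` is uniform in the register, the states and the test, because all of them
vary with `n` in the application. -/
theorem eventually_advantageExponent_le (c l₀ : ℕ) {ε : ℝ} (hε : 0 < ε) {k l : ℕ} (hk : l₀ ≤ k)
    (hkc : 2 * c + 1 ≤ k) (hl : 5 ≤ l) :
    ∀ᶠ n : ℕ in atTop, ∀ (ι : Type) [Fintype ι] [DecidableEq ι] (ρ σ Λ : QOp ι), IsQState ρ →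
      IsQState σ → Λ ∈ effects ι (n ^ l₀) →
      ENNReal.ofReal (advantageExponent ((Λ * ρ).trace.re - (Λ * σ).trace.re) ((n : ℝ)⁻¹ ^ c))
        ≤ gateHypRelEntropy ε (tensorPower ρ (n ^ k)) (tensorPower σ (n ^ k)) (n ^ (k * l))
          / (n : ℝ≥0∞) ^ k := by
  have hexp : ∀ᶠ n : ℕ in atTop, Real.exp (-((n : ℝ) / 16)) ≤ ε := by
    have h1 : Tendsto (fun n : ℕ => (n : ℝ) / 16) atTop atTop :=
      tendsto_natCast_atTop_atTop.atTop_div_const (by norm_num)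
    exact ((Real.tendsto_exp_neg_atTop_nhds_zero.comp h1).eventually_lt_const hε).mono
      fun n hn => hn.le
  filter_upwards [hexp, eventually_ge_atTop 86] with n hnε hn86
  intro ι _ _ ρ σ Λ hρ hσ hΛ
  have hn0 : (0 : ℝ) < n := by positivity
  have hn1 : (1 : ℝ) ≤ n := by exact_mod_cast (by omega : 1 ≤ n)
  set η : ℝ := (n : ℝ)⁻¹ ^ c with hη
  have hη0 : 0 < η := by positivity
  have hη1 : η ≤ 1 := pow_le_one₀ (by positivity) (inv_le_one_of_one_le₀ hn1)
  rcases le_or_gt ((Λ * ρ).trace.re - (Λ * σ).trace.re) η with hle | hlt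
  · rw [advantageExponent, max_eq_right (by linarith)]
    simp
  obtain ⟨Λ', hΛ', h1, h2⟩ := exists_threshold_effect hΛ hρ hσ hη0 hlt (n ^ k)
    (counting_cost_le hn86 hk (by omega) hl)
  have hp := (effect_trace_mem_Icc hΛ hρ).2
  have hq := (effect_trace_mem_Icc hΛ hσ).1
  rw [advantageExponent, max_eq_left (by linarith)]
  set s := (Λ * ρ).trace.re - (Λ * σ).trace.re - η
  have hs1 : 0 < 1 - s ^ 2 := by
    have : s < 1 := by simp only [s]; linarith
    have : 0 < s := by simp only [s]; linarith
    nlinarith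
  -- The error is at most `exp (-n^k η² / 16)`, and `n^k η² = n^{k-2c} ≥ n` since `k ≥ 2c + 1`.
  have hpow : (1 - (η / 4) ^ 2) ^ (n ^ k) ≤ ε := by
    refine le_trans ?_ hnε
    have h3 : 1 - (η / 4) ^ 2 ≤ Real.exp (-(η / 4) ^ 2) := by
      linarith [Real.add_one_le_exp (-(η / 4) ^ 2)]
    refine (pow_le_pow_left₀ (by nlinarith) h3 _).trans ?_
    rw [← Real.exp_nat_mul, Real.exp_le_exp]
    push_cast
    have h4 : (n : ℝ) ≤ n ^ k * η ^ 2 := by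
      rw [hη, ← pow_mul, inv_pow, ← div_eq_mul_inv, le_div_iff₀ (by positivity), ← pow_succ']
      exact pow_le_pow_right₀ hn1 (by omega)
    nlinarith
  have h3 : ENNReal.ofReal ((n : ℝ) ^ k * -Real.log (1 - s ^ 2)) ≤
      gateHypRelEntropy ε (tensorPower ρ (n ^ k)) (tensorPower σ (n ^ k)) (n ^ (k * l)) := by
    refine le_gateHypRelEntropy hΛ' (by linarith) (h2.trans (le_of_eq ?_))
    rw [mul_neg, neg_neg, ← Nat.cast_pow, Real.exp_nat_mul, Real.exp_log hs1]
  rw [ENNReal.le_div_iff_mul_le (Or.inl (by positivity)) (Or.inl (by finiteness)), mul_comm]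
  rwa [ENNReal.ofReal_mul (by positivity), ENNReal.ofReal_pow hn0.le, ENNReal.ofReal_natCast] at h3

/-! ### The inequality -/

/-- The supremum is finite, so it is approached within any `δ ≠ 0`; whether it is attained does not
matter. -/
theorem exists_effect_gateTV_le {ι : Type*} [Fintype ι] [DecidableEq ι] {ρ σ : QOp ι}
    (hρ : IsQState ρ) (hσ : IsQState σ) (G : ℕ) {δ : ℝ≥0∞} (hδ : δ ≠ 0) :
    ∃ Λ ∈ effects ι G,
      gateTV ρ σ G ≤ ENNReal.ofReal ((Λ * ρ).trace.re - (Λ * σ).trace.re) + δ := by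
  have hone : (1 : QOp ι) ∈ effects ι G := by
    refine mem_effects_of_circuit (α := Fin 0) (L := []) (by simp) ∅ (by simp) fun x y => ?_
    rw [tensorOp_eq_diagonal (by simp)]
    simp only [circuitUnitary, List.map_nil, List.prod_nil, Matrix.conjTranspose_one,
      mul_one, Finset.notMem_empty, if_false, proj0_ne_one.symm, false_imp_iff, implies_true,
      if_true, Matrix.diagonal_one, Matrix.one_apply]
    congr 1
    rw [eq_iff_iff]
    exact ⟨fun H => by rw [H], fun H => funext fun i => congrFun H (Sum.inr i)⟩
  have hle1 : gateTV ρ σ G ≤ 1 := by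
    refine iSup₂_le fun Λ hΛ => ENNReal.ofReal_le_one.2 ?_
    rw [mul_sub, Matrix.trace_sub, Complex.sub_re]
    linarith [(effect_trace_mem_Icc hΛ hρ).2, (effect_trace_mem_Icc hΛ hσ).1]
  by_contra! H
  have h0 : gateTV ρ σ G ≠ 0 := (zero_le.trans_lt (H 1 hone)).ne'
  have htop : gateTV ρ σ G ≠ ⊤ := (hle1.trans_lt ENNReal.one_lt_top).ne
  have hsup : gateTV ρ σ G ≤ gateTV ρ σ G - δ := by
    conv_lhs => rw [gateTV]
    refine iSup₂_le fun Λ hΛ => ENNReal.le_sub_of_add_le_right ?_ ?_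
    · exact ((le_add_self.trans_lt (H Λ hΛ)).trans_le hle1).ne_top
    · rw [mul_sub, Matrix.trace_sub, Complex.sub_re]
      exact (H Λ hΛ).le
  exact absurd hsup (not_le.2 (ENNReal.sub_lt_self htop h0 hδ))

/-- For finite `D`, `s² ≤ 1 - e^{-D-δ} ≤ 1 - e^{-D} + δ`, and the square root is subadditive. Since
`η > 0`, `s < 1` and the logarithm has a positive argument. -/
theorem ofReal_max_le_of_advantageExponent_le {t η δ : ℝ} {D : ℝ≥0∞} (ht : t ≤ 1) (hη : 0 < η)
    (hδ : 0 ≤ δ) (h : ENNReal.ofReal (advantageExponent t η) ≤ D + ENNReal.ofReal δ) :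
    ENNReal.ofReal (max (t - η) 0)
      ≤ (1 - EReal.exp (-(D : EReal))) ^ (1 / 2 : ℝ) + ENNReal.ofReal (√δ) := by
  rw [advantageExponent] at h
  set s := max (t - η) 0 with hs
  have hs0 : 0 ≤ s := le_max_right _ _
  have hs1 : s < 1 := max_lt (by linarith) one_pos
  have hpos : 0 < 1 - s ^ 2 := by nlinarith
  induction D with
  | top =>
    simp only [EReal.coe_ennreal_top, EReal.neg_top, EReal.exp_bot, tsub_zero, ENNReal.one_rpow]
    exact (ENNReal.ofReal_le_one.2 hs1.le).trans le_self_add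
  | coe d =>
    have h1 : -Real.log (1 - s ^ 2) ≤ d + δ := by
      rw [← ENNReal.ofReal_coe_nnreal, ← ENNReal.ofReal_add d.coe_nonneg hδ] at h
      exact (ENNReal.ofReal_le_ofReal_iff (add_nonneg d.coe_nonneg hδ)).1 h
    have h2 : 1 - EReal.exp (-(((d : ℝ≥0∞)) : EReal)) = ENNReal.ofReal (1 - Real.exp (-d)) := by
      have : (-(((d : ℝ≥0∞)) : EReal)) = ((-(d : ℝ) : ℝ) : EReal) := by
        rw [EReal.coe_neg]; rfl
      rw [this, EReal.exp_coe, ENNReal.ofReal_sub _ (Real.exp_pos _).le, ENNReal.ofReal_one]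
    have hd : 0 ≤ 1 - Real.exp (-(d : ℝ)) := by
      have : Real.exp (-(d : ℝ)) ≤ 1 := Real.exp_le_one_iff.2 (neg_nonpos.2 d.coe_nonneg)
      linarith
    rw [h2, ENNReal.ofReal_rpow_of_nonneg hd (by norm_num), ← Real.sqrt_eq_rpow,
      ← ENNReal.ofReal_add (Real.sqrt_nonneg _) (Real.sqrt_nonneg _)]
    refine ENNReal.ofReal_le_ofReal ?_
    refine le_trans (Real.le_sqrt_of_sq_le (y := 1 - Real.exp (-d) + δ) ?_) ?_
    · have h3 : Real.exp (-(d + δ)) ≤ 1 - s ^ 2 := by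
        rw [← Real.le_log_iff_exp_le hpos]; linarith
      have h4 : Real.exp (-(d : ℝ)) * (1 - δ) ≤ Real.exp (-(d + δ)) := by
        rw [neg_add, Real.exp_add]
        refine mul_le_mul_of_nonneg_left ?_ (Real.exp_pos _).le
        linarith [Real.add_one_le_exp (-δ)]
      nlinarith [Real.exp_pos (-(d : ℝ))]
    · rw [Real.sqrt_le_iff]
      refine ⟨by positivity, ?_⟩
      nlinarith [Real.sq_sqrt hd, Real.sq_sqrt hδ, mul_nonneg (Real.sqrt_nonneg (1 - Real.exp (-d)))
        (Real.sqrt_nonneg δ)]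

theorem natCast_inv_pow_eq_ofReal {n : ℕ} (hn : n ≠ 0) (c : ℕ) :
    ((n : ℝ≥0∞)⁻¹) ^ c = ENNReal.ofReal ((n : ℝ)⁻¹ ^ c) := by
  have : (0 : ℝ) < n := by positivity
  rw [ENNReal.ofReal_pow (by positivity), ENNReal.ofReal_inv_of_pos this, ENNReal.ofReal_natCast]

/-- The computational Bretagnolle–Huber inequality. -/
theorem mainTheorem5 (N : ℕ → ℕ) (ρ σ : ∀ n, QOp (Fin (N n)))
    (hρ : ∀ n, IsQState (ρ n)) (hσ : ∀ n, IsQState (σ n))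
    (T D : ℕ → ℝ≥0∞) (hT : IsCompTV ρ σ T) (hD : IsCompRelEntropy ρ σ D) :
    NeglLE T (fun n => (1 - EReal.exp (-(D n : EReal))) ^ (1 / 2 : ℝ)) := by
  rw [neglLE_iff]
  intro c
  obtain ⟨l₀, hl₀⟩ := (eventually_asympDist_lt_exp hT (c + 1)).exists
  have hδ : ∀ n : ℕ, ((n : ℝ≥0∞)⁻¹) ^ (c + 1) ≠ 0 := fun n =>
    pow_ne_zero _ (ENNReal.inv_ne_zero.2 (ENNReal.natCast_ne_top n))
  choose Λ hΛ hΛle using fun n => exists_effect_gateTV_le (hρ n) (hσ n) (n ^ l₀) (hδ n)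
  let t : ℕ → ℝ := fun n => (Λ n * ρ n).trace.re - (Λ n * σ n).trace.re
  let a : ℕ → ℝ≥0∞ := fun n => ENNReal.ofReal (advantageExponent (t n) ((n : ℝ)⁻¹ ^ (c + 1)))
  obtain ⟨M, E, hM, hE⟩ := hD
  -- Errors in the entropy enter under a square root, so the precision here is `x²` with `x =
  -- n^{-(c+1)}`.
  obtain ⟨ε, ⟨hεM, hεE, hεl⟩, hε⟩ := (((eventually_asympDist_lt_exp hM (2 * (c + 1))).and hE).and
    self_mem_nhdsWithin).exists
  obtain ⟨l, ⟨hlE, hlim⟩, hl5⟩ := (((eventually_asympDist_lt_exp hεE (2 * (c + 1))).and hεl).and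
    (eventually_ge_atTop 5)).exists
  -- The function `a` is below the regularized entropies for all large `k`, hence below their limit
  -- inferior.
  have ha : NeglLE a (E ε l) := by
    refine hlim.1 a ?_
    filter_upwards [eventually_ge_atTop l₀, eventually_ge_atTop (2 * (c + 1) + 1)] with k hk hkc
    rw [neglLE_iff]
    intro _
    filter_upwards [eventually_advantageExponent_le (c + 1) l₀ hε hk hkc hl5] with n hn
    exact (hn _ _ _ _ (hρ n) (hσ n) (hΛ n)).trans le_self_add
  filter_upwards [eventually_le_add_of_asympDist_lt hl₀, eventually_le_add_of_asympDist_lt hεM,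
    eventually_le_add_of_asympDist_lt hlE, neglLE_iff.1 ha (2 * (c + 1)),
    eventually_ge_atTop 6] with n h1 h2 h3 h4 hn
  have hn0 : n ≠ 0 := by omega
  have hn6 : (6 : ℝ) ≤ n := by exact_mod_cast hn
  set x : ℝ := (n : ℝ)⁻¹ ^ (c + 1) with hx
  have hx0 : 0 < x := by positivity
  have hxx : (n : ℝ)⁻¹ ^ (2 * (c + 1)) = x ^ 2 := by rw [hx, ← pow_mul, mul_comm 2]
  have ht1 : t n ≤ 1 := by
    have h5 := (effect_trace_mem_Icc (hΛ n) (hρ n)).2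
    have h6 := (effect_trace_mem_Icc (hΛ n) (hσ n)).1
    simp only [t]; linarith
  have hb := hΛle n
  simp only [natCast_inv_pow_eq_ofReal hn0, hxx, ← hx] at h1 h2 h3 h4 hb ⊢
  have h5 : a n ≤ D n + ENNReal.ofReal (3 * x ^ 2) := by
    have h6 : ENNReal.ofReal (3 * x ^ 2)
        = ENNReal.ofReal (x ^ 2) + ENNReal.ofReal (x ^ 2) + ENNReal.ofReal (x ^ 2) := by
      rw [← ENNReal.ofReal_add (by positivity) (by positivity),
        ← ENNReal.ofReal_add (by positivity) (by positivity)]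
      congr 1; ring
    calc a n ≤ E ε l n + ENNReal.ofReal (x ^ 2) := h4
      _ ≤ M ε n + ENNReal.ofReal (x ^ 2) + ENNReal.ofReal (x ^ 2) := by gcongr; exact h3.1
      _ ≤ D n + ENNReal.ofReal (x ^ 2) + ENNReal.ofReal (x ^ 2) + ENNReal.ofReal (x ^ 2) := by
        gcongr; exact h2.1
      _ = D n + ENNReal.ofReal (3 * x ^ 2) := by rw [h6]; ring
  have h7 := ofReal_max_le_of_advantageExponent_le ht1 hx0 (by positivity) h5
  have hsqrt : √(3 * x ^ 2) ≤ 2 * x :=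
    Real.sqrt_le_iff.2 ⟨by positivity, by nlinarith⟩
  set B := (1 - EReal.exp (-(D n : EReal))) ^ (1 / 2 : ℝ)
  calc T n ≤ gateTV (ρ n) (σ n) (n ^ l₀) + ENNReal.ofReal x := h1.2
    _ ≤ ENNReal.ofReal (t n) + ENNReal.ofReal x + ENNReal.ofReal x := by gcongr
    _ ≤ ENNReal.ofReal (max (t n - x) 0 + x) + ENNReal.ofReal x + ENNReal.ofReal x := by
      gcongr
      linarith [le_max_left (t n - x) 0]
    _ = ENNReal.ofReal (max (t n - x) 0) + ENNReal.ofReal x + ENNReal.ofReal x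
        + ENNReal.ofReal x := by rw [ENNReal.ofReal_add (le_max_right _ _) hx0.le]
    _ ≤ B + ENNReal.ofReal (2 * x) + ENNReal.ofReal x + ENNReal.ofReal x + ENNReal.ofReal x := by
      gcongr
      refine h7.trans ?_
      gcongr
    _ = B + ENNReal.ofReal (5 * x) := by
      simp only [add_assoc]
      congr 1
      rw [← ENNReal.ofReal_add hx0.le hx0.le, ← ENNReal.ofReal_add hx0.le (by positivity),
        ← ENNReal.ofReal_add (by positivity) (by positivity)]
      congr 1; ring
    -- The spare factor `n⁻¹` in `x` absorbs the constant `5`.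
    _ ≤ B + ENNReal.ofReal ((n : ℝ)⁻¹ ^ c) := by
      gcongr
      rw [hx, pow_succ, mul_comm, mul_assoc]
      refine mul_le_of_le_one_right (by positivity) ?_
      rw [inv_mul_le_iff₀ (by positivity)]
      linarith
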